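/- Let $d\ge 2$ and let $\Gamma$ be a closed smooth curve in $\mathbb R^d$, i.e. a $C^\infty$ immersion $\gamma$ of a circle. For $a>0$ put $\Omega_a:=\{x\in\mathbb R^d:\operatorname{dist}(x,\Gamma)<a\}$. Say that $\Omega_a$ does not overlap itself if, for every smooth unit normal vector field $N$ along $\Gamma$, the map $(q,t)\mapsto q+tN(q)$ from $\Gamma\times(0,a)$ to $\mathbb R^d$ ($\Gamma$ being parametrised by the circle) is a smooth diffeomorphism onto its image. For $\Omega\subset\mathbb R^d$ let $$h(\Omega):=\inf_{S}\frac{|\partial S|}{|S|},$$ where the infimum is over all bounded Borel sets $S\subset\Omega$ of positive Lebesgue measure $|S|$, and where $|\partial S|:=\sup\{\int_S\operatorname{div}\varphi\,dx:\varphi\in C^1_c(\mathbb R^d;\mathbb R^d),\ |\varphi|\le 1\}$ is the perimeter of $S$; a minimiser is called a Cheeger set of $\Omega$. If $a>0$ is so small that $\Omega_b$ does not overlap itself for some $b>a$, then $$h(\Omega_a)=\frac{d-1}{a},$$ so that the Cheeger constant is independent of the shape of $\Gamma$. Moreover $\Omega_a$ is a Cheeger set of itself, and it is the only one: every Cheeger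 set of $\Omega_a$ coincides with $\Omega_a$ up to a set of Lebesgue measure zero. -/

import Mathlib

open MeasureTheory Set
open scoped ENNReal ContDiff

noncomputable section

/-- Divergence of a vector field on `ℝ^d`. -/
def divergence {d : ℕ} (φ : EuclideanSpace ℝ (Fin d) → EuclideanSpace ℝ (Fin d))
    (x : EuclideanSpace ℝ (Fin d)) : ℝ :=
  ∑ i : Fin d, (fderiv ℝ φ x (EuclideanSpace.single i 1)) i

/-- The admissible fields in the variational definition of the perimeter:
`φ ∈ C¹_c(ℝ^d; ℝ^d)` with `|φ| ≤ 1`. -/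
structure IsPerimeterTestField {d : ℕ}
    (φ : EuclideanSpace ℝ (Fin d) → EuclideanSpace ℝ (Fin d)) : Prop where
  contDiff : ContDiff ℝ 1 φ
  hasCompactSupport : HasCompactSupport φ
  norm_le_one : ∀ x, ‖φ x‖ ≤ 1

/-- The (De Giorgi) perimeter of `S` in `ℝ^d`, possibly infinite. The field `φ = 0` is admissible,
so truncating the integrals at `0` does not change the supremum. -/
def perimeter {d : ℕ} (S : Set (EuclideanSpace ℝ (Fin d))) : ℝ≥0∞ :=
  ⨆ (φ : EuclideanSpace ℝ (Fin d) → EuclideanSpace ℝ (Fin d)) (_ : IsPerimeterTestField φ),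
    ENNReal.ofReal (∫ x in S, divergence φ x)

/-- The competitors in the Cheeger problem of `Ω`: bounded Borel subsets of `Ω`
of positive volume. -/
structure IsCheegerCompetitor {d : ℕ} (Ω S : Set (EuclideanSpace ℝ (Fin d))) : Prop where
  subset : S ⊆ Ω
  measurableSet : MeasurableSet S
  isBounded : Bornology.IsBounded S
  volume_pos : 0 < volume S

/-- The Cheeger constant `h(Ω) = inf |∂S| / |S|`. -/
def cheegerConstant {d : ℕ} (Ω : Set (EuclideanSpace ℝ (Fin d))) : ℝ≥0∞ :=
  ⨅ (S : Set (EuclideanSpace ℝ (Fin d))) (_ : IsCheegerCompetitor Ω S), perimeter S / volume S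

/-- A Cheeger set of `Ω` is a minimiser in the definition of the Cheeger constant. -/
structure IsCheegerSet {d : ℕ} (Ω S : Set (EuclideanSpace ℝ (Fin d))) : Prop where
  competitor : IsCheegerCompetitor Ω S
  minimal : perimeter S / volume S = cheegerConstant Ω

/-- A closed smooth curve in `ℝ^d`: a `C^∞` immersion of the circle `ℝ/Lℤ`
(self-intersections are not excluded here). -/
structure IsClosedSmoothCurve {d : ℕ} {L : ℝ}
    (γ : AddCircle L → EuclideanSpace ℝ (Fin d)) : Prop where
  length_pos : 0 < L
  contDiff : ContDiff ℝ ∞ (fun s : ℝ => γ (s : AddCircle L))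
  regular : ∀ s : ℝ, deriv (fun s : ℝ => γ (s : AddCircle L)) s ≠ 0

/-- A smooth unit normal vector field along the closed curve `γ`. -/
structure IsUnitNormalField {d : ℕ} {L : ℝ}
    (γ N : AddCircle L → EuclideanSpace ℝ (Fin d)) : Prop where
  contDiff : ContDiff ℝ ∞ (fun s : ℝ => N (s : AddCircle L))
  norm_eq_one : ∀ q, ‖N q‖ = 1
  normal : ∀ s : ℝ, inner ℝ (N (s : AddCircle L)) (deriv (fun s : ℝ => γ (s : AddCircle L)) s) = 0

/-- The tube of radius `a` about `γ` does not overlap itself: for every smooth unit normal field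
`N`, the map `(q, t) ↦ q + t N(q)` is a diffeomorphism of (circle) `× (0, a)` onto its image,
i.e. a topological embedding whose differential is injective at every point. -/
def TubeDoesNotOverlap {d : ℕ} {L : ℝ}
    (γ : AddCircle L → EuclideanSpace ℝ (Fin d)) (a : ℝ) : Prop :=
  ∀ N : AddCircle L → EuclideanSpace ℝ (Fin d), IsUnitNormalField γ N →
    Topology.IsEmbedding
        (fun p : AddCircle L × Ioo (0 : ℝ) a => γ p.1 + (p.2 : ℝ) • N p.1) ∧
      ∀ s : ℝ, ∀ t ∈ Ioo (0 : ℝ) a,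
        Function.Injective
          (fderiv ℝ (fun p : ℝ × ℝ => γ (p.1 : AddCircle L) + p.2 • N (p.1 : AddCircle L)) (s, t))

/-- The tube `{x : dist (x, Γ) < a}` about the trace `Γ` of `γ`. -/
def tube {d : ℕ} {L : ℝ} (γ : AddCircle L → EuclideanSpace ℝ (Fin d)) (a : ℝ) :
    Set (EuclideanSpace ℝ (Fin d)) :=
  {x | Metric.infDist x (range γ) < a}

end

open Filter Topology Metric

/-! The tube is calibrated by an explicit vector field. Let `y` be the vector from the nearest point
of the curve to `x`, and `κ` the curvature vector at that point. For `0 < A < b` the field `f_A = y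
/ A - (A² - |y|²) / (2A(1 - ⟨κ, y⟩)) κ` has constant divergence `(d - 1) / A`, because the `κ` term
cancels the distortion of normal coordinates caused by curvature (`divergence_footField`). It
satisfies `|f_A| < 1` at distance less than `A` (`calibration_norm_bound`) and is the outer unit
normal at distance `A`.

Testing the perimeter of `S ⊆ Ω_a` with `f_a` gives `|∂S| ≥ (d - 1)/a · |S|`, and comparing any test
field with `f_a` near `∂Ω_a` gives the reverse inequality for `Ω_a`. Since `|f_a| < 1` inside, the
lower bound survives small perturbations of the field supported in `Ω_a`. A Cheeger set therefore
satisfies `∫ div ψ = 0` for all such perturbations `ψ`, has no boundary in the connected set `Ω_a`,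
and fills it up to a null set.

The field exists as soon as points at distance less than `b` have a unique nearest parameter and
there are no focal points there. Both must be extracted from injectivity along each single normal
field. For `d ≥ 3` a smooth normal field passes through any two prescribed unit normals at distinct
parameters, by a Hausdorff dimension count (`exists_normalField_through_two`), so any two normal
segments can be compared. For `d = 2` there are only the two fields `±N`, which never compare
opposite sides of the curve. Double points are then excluded by following two oppositely directed
strands towards each other (`injective_plane`), and meetings of opposite sides at a nearest point by
lifting a circle-valued map through the covering `ℝ → ℝ/ℤ` (`not_nearest_of_opposite_side`). -/

/-- Euclidean space of dimension `d`. -/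
abbrev Euc (d : ℕ) := EuclideanSpace ℝ (Fin d)

/-! ### Divergence calculus and the divergence theorem for compactly supported fields -/

section Divergence

variable {d : ℕ}

theorem sum_apply_single_mul (ℓ : Euc d →L[ℝ] ℝ) (v : Euc d) :
    ∑ i, ℓ (EuclideanSpace.single i 1) * v i = ℓ v := by
  have hv : v = ∑ i, v i • (EuclideanSpace.single i (1 : ℝ) : Euc d) := by
    ext j
    simp [Pi.single_apply]
  conv_rhs => rw [hv]
  simp [mul_comm]

theorem divergence_eq_of_hasFDerivAt {φ : Euc d → Euc d} {A : Euc d →L[ℝ] Euc d} {x : Euc d}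
    (h : HasFDerivAt φ A x) : divergence φ x = ∑ i, (A (EuclideanSpace.single i 1)) i := by
  simp only [divergence, h.fderiv]

theorem divergence_congr {φ ψ : Euc d → Euc d} {x : Euc d} (h : φ =ᶠ[𝓝 x] ψ) :
    divergence φ x = divergence ψ x := by
  simp only [divergence, h.fderiv_eq]

theorem divergence_add {φ ψ : Euc d → Euc d} {x : Euc d} (hφ : DifferentiableAt ℝ φ x)
    (hψ : DifferentiableAt ℝ ψ x) :
    divergence (fun z => φ z + ψ z) x = divergence φ x + divergence ψ x := by
  rw [divergence_eq_of_hasFDerivAt (φ := fun z => φ z + ψ z) (hφ.hasFDerivAt.add hψ.hasFDerivAt)]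
  simp [divergence, Finset.sum_add_distrib]

theorem divergence_const_smul {φ : Euc d → Euc d} {x : Euc d} (c : ℝ)
    (hφ : DifferentiableAt ℝ φ x) :
    divergence (fun z => c • φ z) x = c * divergence φ x := by
  rw [divergence_eq_of_hasFDerivAt (φ := fun z => c • φ z) (hφ.hasFDerivAt.const_smul c)]
  simp [divergence, Finset.mul_sum]

theorem divergence_smul {χ : Euc d → ℝ} {φ : Euc d → Euc d} {x : Euc d}
    (hχ : DifferentiableAt ℝ χ x) (hφ : DifferentiableAt ℝ φ x) :
    divergence (fun z => χ z • φ z) x = χ x * divergence φ x + fderiv ℝ χ x (φ x) := by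
  rw [divergence_eq_of_hasFDerivAt (φ := fun z => χ z • φ z) (hχ.hasFDerivAt.smul hφ.hasFDerivAt)]
  simp only [divergence, ← sum_apply_single_mul (fderiv ℝ χ x) (φ x), Finset.mul_sum,
    ← Finset.sum_add_distrib]
  simp

theorem divergence_smul_const {χ : Euc d → ℝ} {x : Euc d} (v : Euc d)
    (hχ : DifferentiableAt ℝ χ x) :
    divergence (fun z => χ z • v) x = fderiv ℝ χ x v := by
  rw [divergence_smul hχ (differentiableAt_const v)]
  simp [divergence]

theorem continuous_divergence {φ : Euc d → Euc d} (h : ContDiff ℝ 1 φ) :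
    Continuous (divergence φ) := by
  have := h.continuous_fderiv one_ne_zero
  unfold divergence
  fun_prop

theorem hasCompactSupport_divergence {φ : Euc d → Euc d} (hc : HasCompactSupport φ) :
    HasCompactSupport (divergence φ) := by
  refine (hc.fderiv (𝕜 := ℝ)).comp_left (g := fun A : Euc d →L[ℝ] Euc d =>
    ∑ i, (A (EuclideanSpace.single i 1)) i) ?_
  simp

theorem integrable_divergence {φ : Euc d → Euc d} (h : ContDiff ℝ 1 φ)
    (hc : HasCompactSupport φ) : Integrable (divergence φ) :=
  (continuous_divergence h).integrable_of_hasCompactSupport (hasCompactSupport_divergence hc)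

theorem integral_fderiv_apply_eq_zero {g : Euc d → ℝ} (h : ContDiff ℝ 1 g)
    (hc : HasCompactSupport g) (v : Euc d) : ∫ x, fderiv ℝ g x v = 0 := by
  have h1 : Continuous fun x => fderiv ℝ g x v :=
    (h.continuous_fderiv one_ne_zero).clm_apply continuous_const
  have h2 : HasCompactSupport fun x => fderiv ℝ g x v :=
    (hc.fderiv (𝕜 := ℝ)).comp_left (g := fun A : Euc d →L[ℝ] ℝ => A v) (by simp)
  -- Integration by parts against the constant function `1`.
  have := integral_mul_fderiv_eq_neg_fderiv_mul_of_integrable (μ := (volume : Measure (Euc d)))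
    (f := fun _ => (1 : ℝ)) (g := g) (v := v) (by simp)
    (by simpa using h1.integrable_of_hasCompactSupport h2)
    (by simpa using h.continuous.integrable_of_hasCompactSupport hc)
    (fun x _ => differentiableAt_const _) (fun x _ => h.differentiable one_ne_zero x)
  simpa using this

theorem integral_divergence_eq_zero {φ : Euc d → Euc d} (h : ContDiff ℝ 1 φ)
    (hc : HasCompactSupport φ) : ∫ x, divergence φ x = 0 := by
  have hi : ∀ i, ContDiff ℝ 1 fun x => φ x i := fun i => by fun_prop
  have hci : ∀ i, HasCompactSupport fun x => φ x i := fun i =>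
    hc.comp_left (g := fun v : Euc d => v i) (by simp)
  have hd : ∀ x i, (fderiv ℝ φ x (EuclideanSpace.single i 1)) i =
      fderiv ℝ (fun z => φ z i) x (EuclideanSpace.single i 1) := by
    intro x i
    have := ((EuclideanSpace.proj (𝕜 := ℝ) i : Euc d →L[ℝ] ℝ).hasFDerivAt (x := φ x)).comp x
      (h.differentiable one_ne_zero x).hasFDerivAt
    have h3 : fderiv ℝ (fun z => φ z i) x = _ := this.fderiv
    rw [h3]
    simp
  simp only [divergence, hd]
  rw [integral_finsetSum]
  · exact Finset.sum_eq_zero fun i _ => integral_fderiv_apply_eq_zero (hi i) (hci i) _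
  · intro i _
    refine Continuous.integrable_of_hasCompactSupport
      (((hi i).continuous_fderiv one_ne_zero).clm_apply continuous_const) ?_
    exact ((hci i).fderiv (𝕜 := ℝ)).comp_left (g := fun A : Euc d →L[ℝ] ℝ => A _) (by simp)

end Divergence

/-! ### Cutoffs as functions of the squared distance -/

section Cutoff

/-- A smooth nonincreasing cutoff, equal to `1` on `(-∞, r²]` and to `0` on `[m², ∞)`. -/
noncomputable def sqCutoff (r m z : ℝ) : ℝ := Real.smoothTransition ((m ^ 2 - z) / (m ^ 2 - r ^ 2))

variable {r m : ℝ}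

theorem sqCutoff_nonneg (z : ℝ) : 0 ≤ sqCutoff r m z := Real.smoothTransition.nonneg _

theorem sqCutoff_le_one (z : ℝ) : sqCutoff r m z ≤ 1 := Real.smoothTransition.le_one _

theorem sqCutoff_contDiff : ContDiff ℝ 1 (sqCutoff r m) :=
  Real.smoothTransition.contDiff.comp ((contDiff_const.sub contDiff_id).div_const _)

theorem sqCutoff_eq_one (hr : 0 ≤ r) (hrm : r < m) {z : ℝ} (hz : z ≤ r ^ 2) :
    sqCutoff r m z = 1 := by
  have : 0 < m ^ 2 - r ^ 2 := by nlinarith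
  exact Real.smoothTransition.one_of_one_le ((one_le_div this).2 (by linarith))

theorem sqCutoff_eq_zero (hr : 0 ≤ r) (hrm : r < m) {z : ℝ} (hz : m ^ 2 ≤ z) :
    sqCutoff r m z = 0 := by
  have : 0 < m ^ 2 - r ^ 2 := by nlinarith
  exact Real.smoothTransition.zero_of_nonpos (div_nonpos_of_nonpos_of_nonneg (by linarith) this.le)

theorem deriv_sqCutoff_nonpos (hr : 0 ≤ r) (hrm : r < m) (z : ℝ) :
    deriv (sqCutoff r m) z ≤ 0 := by
  have : 0 < m ^ 2 - r ^ 2 := by nlinarith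
  refine Antitone.deriv_nonpos (fun x y h => Real.smoothTransition.monotone ?_)
  gcongr

theorem deriv_sqCutoff_eq_zero (hr : 0 ≤ r) (hrm : r < m) {z : ℝ} (hz : z < r ^ 2) :
    deriv (sqCutoff r m) z = 0 := by
  have : sqCutoff r m =ᶠ[𝓝 z] fun _ => 1 := by
    filter_upwards [Iio_mem_nhds hz] with w hw using sqCutoff_eq_one hr hrm (le_of_lt hw)
  rw [this.deriv_eq]; simp

theorem deriv_sqCutoff_eq_zero_of_ge (hr : 0 ≤ r) (hrm : r < m) {z : ℝ} (hz : m ^ 2 < z) :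
    deriv (sqCutoff r m) z = 0 := by
  have : sqCutoff r m =ᶠ[𝓝 z] fun _ => 0 := by
    filter_upwards [Ioi_mem_nhds hz] with w hw using sqCutoff_eq_zero hr hrm (le_of_lt hw)
  rw [this.deriv_eq]; simp

end Cutoff

/-! ### Calibrations and perimeter bounds -/

/-- A family of vector fields `f A`, `0 < A < b`, of constant divergence `(d - 1) / A` on the tube
of radius `b` about `Γ`, which calibrates the tube of radius `A`; `y x` is the vector from the
nearest point of `Γ` to `x`. -/
structure IsTubeCalibration {d : ℕ} (Γ : Set (Euc d)) (b : ℝ) (y : Euc d → Euc d)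
    (f : ℝ → Euc d → Euc d) : Prop where
  isCompact : IsCompact Γ
  nonempty : Γ.Nonempty
  norm_y : ∀ x, infDist x Γ < b → ‖y x‖ = infDist x Γ
  contDiffAt_sq : ∀ x, infDist x Γ < b → ContDiffAt ℝ 1 (fun z => infDist z Γ ^ 2) x
  fderiv_sq : ∀ x, infDist x Γ < b → ∀ v,
    fderiv ℝ (fun z => infDist z Γ ^ 2) x v = 2 * inner ℝ (y x) v
  contDiffAt : ∀ A, 0 < A → A < b → ∀ x, infDist x Γ < b → ContDiffAt ℝ 1 (f A) x
  divergence_eq : ∀ A, 0 < A → A < b → ∀ x, infDist x Γ < b →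
    divergence (f A) x = ((d : ℝ) - 1) / A
  norm_sq_le : ∀ A, 0 < A → A < b → ∀ x, infDist x Γ ≤ A →
    (A ^ 2 - infDist x Γ ^ 2) / (4 * A ^ 2) ≤ 1 - ‖f A x‖ ^ 2
  inner_ge : ∀ A, 0 < A → A < b → ∃ C : ℝ, ∀ x, infDist x Γ ≤ A →
    infDist x Γ ^ 2 / A - C * (A ^ 2 - infDist x Γ ^ 2) ≤ inner ℝ (f A x) (y x)

namespace IsTubeCalibration

variable {d : ℕ} {Γ : Set (Euc d)} {b : ℝ} {y : Euc d → Euc d} {f : ℝ → Euc d → Euc d}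

theorem isCompact_le (H : IsTubeCalibration Γ b y f) (m : ℝ) :
    IsCompact {x | infDist x Γ ≤ m} := by
  refine isCompact_of_isClosed_isBounded
    (isClosed_le (continuous_infDist_pt Γ) continuous_const) ?_
  obtain ⟨p, hp⟩ := H.nonempty
  obtain ⟨R, hR⟩ := H.isCompact.isBounded.subset_closedBall p
  refine (isBounded_closedBall (x := p) (r := m + R)).subset fun x hx => ?_
  obtain ⟨q, hq, hxq⟩ := H.isCompact.exists_infDist_eq_dist H.nonempty x
  have h1 : dist q p ≤ R := hR hq
  have h2 : dist x q ≤ m := hxq ▸ hx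
  exact (dist_triangle x q p).trans (add_le_add h2 h1)

/-- Cutoffs depend on the squared distance because the distance itself is not differentiable on `Γ`.
Where `g` may fail to be smooth, at distance at least `b > m`, the product vanishes locally. -/
theorem contDiff_cutoff_smul (H : IsTubeCalibration Γ b y f) {h : ℝ → ℝ} (hh : ContDiff ℝ 1 h)
    {m : ℝ} (hmb : m < b) (hz : ∀ z, m ^ 2 ≤ z → h z = 0) (hm : 0 ≤ m)
    {F : Type*} [NormedAddCommGroup F] [NormedSpace ℝ F] {g : Euc d → F}
    (hg : ∀ x, infDist x Γ < b → ContDiffAt ℝ 1 g x) :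
    ContDiff ℝ 1 fun x => h (infDist x Γ ^ 2) • g x := by
  refine contDiff_iff_contDiffAt.2 fun x => ?_
  by_cases hx : infDist x Γ < b
  · exact (hh.contDiffAt.comp x (H.contDiffAt_sq x hx)).smul (hg x hx)
  · have : ∀ᶠ z in 𝓝 x, m < infDist z Γ :=
      (continuous_infDist_pt Γ).continuousAt.eventually_const_lt (by linarith)
    refine (contDiffAt_const (c := (0 : F))).congr_of_eventuallyEq ?_
    filter_upwards [this] with z hzm
    rw [hz _ (by gcongr), zero_smul]

theorem hasCompactSupport_cutoff_smul (H : IsTubeCalibration Γ b y f) {h : ℝ → ℝ}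
    {m : ℝ} (hz : ∀ z, m ^ 2 ≤ z → h z = 0) (hm : 0 ≤ m)
    {F : Type*} [NormedAddCommGroup F] [NormedSpace ℝ F] (g : Euc d → F) :
    HasCompactSupport fun x => h (infDist x Γ ^ 2) • g x := by
  refine HasCompactSupport.intro (H.isCompact_le m) fun x hx => ?_
  have hx' : m < infDist x Γ := not_le.1 hx
  rw [hz _ (by gcongr), zero_smul]

theorem fderiv_cutoff (H : IsTubeCalibration Γ b y f) {h : ℝ → ℝ} (hh : ContDiff ℝ 1 h)
    {x : Euc d} (hx : infDist x Γ < b) (v : Euc d) :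
    fderiv ℝ (fun z => h (infDist z Γ ^ 2)) x v =
      deriv h (infDist x Γ ^ 2) * (2 * inner ℝ (y x) v) := by
  have h1 := ((hh.differentiable one_ne_zero (infDist x Γ ^ 2)).hasDerivAt.comp_hasFDerivAt x
    ((H.contDiffAt_sq x hx).differentiableAt one_ne_zero).hasFDerivAt)
  have h2 : fderiv ℝ (fun z => h (infDist z Γ ^ 2)) x = _ := h1.fderiv
  rw [h2, ← H.fderiv_sq x hx v]
  simp

theorem volume_lt_top (H : IsTubeCalibration Γ b y f) {S : Set (Euc d)} {a : ℝ}
    (hS : ∀ x ∈ S, infDist x Γ < a) : volume S < ⊤ :=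
  (measure_mono fun x hx => (hS x hx).le).trans_lt (H.isCompact_le a).measure_lt_top

theorem norm_le_one (H : IsTubeCalibration Γ b y f) {A : ℝ} (hA : 0 < A) (hAb : A < b)
    {x : Euc d} (hx : infDist x Γ ≤ A) : ‖f A x‖ ≤ 1 := by
  have h1 := H.norm_sq_le A hA hAb x hx
  have h2 : 0 ≤ (A ^ 2 - infDist x Γ ^ 2) / (4 * A ^ 2) :=
    div_nonneg (by nlinarith [infDist_nonneg (x := x) (s := Γ)]) (by positivity)
  nlinarith [norm_nonneg (f A x)]

/-- The calibration bounds the perimeter of subsets of a tube from below; inside the tube there is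
room for an arbitrary small perturbation of the field. -/
theorem exists_le_perimeter (H : IsTubeCalibration Γ b y f) {a : ℝ} (ha : 0 < a) (hab : a < b)
    {ψ : Euc d → Euc d} (hψ : ContDiff ℝ 1 ψ) (hψc : HasCompactSupport ψ)
    (hψt : ∀ x ∈ tsupport ψ, infDist x Γ < a) :
    ∃ ε : ℝ, 0 < ε ∧ ∀ S : Set (Euc d), MeasurableSet S → (∀ x ∈ S, infDist x Γ < a) →
      ENNReal.ofReal (((d : ℝ) - 1) / a * volume.real S + ε * ∫ x in S, divergence ψ x) ≤
        perimeter S := by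
  obtain ⟨r, hr0, hra, hr⟩ : ∃ r, 0 ≤ r ∧ r < a ∧ ∀ x ∈ tsupport ψ, infDist x Γ ≤ r := by
    rcases (tsupport ψ).eq_empty_or_nonempty with he | hne
    · exact ⟨0, le_rfl, ha, by simp [he]⟩
    · obtain ⟨x, hx, hmax⟩ := IsCompact.exists_isMaxOn hψc hne
        (continuous_infDist_pt Γ).continuousOn
      exact ⟨infDist x Γ, infDist_nonneg, hψt x hx, fun z hz => hmax hz⟩
  obtain ⟨M, hM⟩ := hψc.exists_bound_of_continuous hψ.continuous
  have hM0 : 0 ≤ M := (norm_nonneg _).trans (hM 0)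
  -- On the support of `ψ`, and for every `A` in `(a, b)`, `1 - ‖f A x‖²` is at least `(a² - r²) /
  -- (4b²) = 2τ`. Hence `‖f A x‖ ≤ 1 - τ`, which leaves room for a perturbation of size `τ`,
  -- uniformly in `A`.
  set τ : ℝ := (a ^ 2 - r ^ 2) / (8 * b ^ 2) with hτ
  have hb : 0 < b := ha.trans hab
  have hτ0 : 0 < τ := div_pos (by nlinarith) (by positivity)
  have hτ1 : τ ≤ 1 := by
    rw [hτ, div_le_one (by positivity)]
    nlinarith
  refine ⟨τ / (M + 1), by positivity, fun S hS hSa => ?_⟩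
  set ε := τ / (M + 1) with hε
  have hεM : ε * M ≤ τ := by
    rw [hε, div_mul_eq_mul_div, div_le_iff₀ (by positivity)]
    nlinarith
  have hε0 : 0 < ε := by positivity
  have hfin := H.volume_lt_top hSa
  -- Working with `A > a` leaves a shell between the radii `a` and `A` in which `f A`, still of norm
  -- at most `1`, can be cut off without changing it on `S`. The bound for `a` follows as `A → a`.
  have key : ∀ A, a < A → A < b →
      ENNReal.ofReal (((d : ℝ) - 1) / A * volume.real S + ε * ∫ x in S, divergence ψ x) ≤
        perimeter S := by
    intro A haA hAb
    have hA : 0 < A := ha.trans haA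
    obtain ⟨m, ham, hmA⟩ := exists_between haA
    have hm : 0 ≤ m := by linarith
    set h := sqCutoff a m
    have hz : ∀ z, m ^ 2 ≤ z → h z = 0 := fun z hz => sqCutoff_eq_zero ha.le ham hz
    set φ₀ : Euc d → Euc d := fun x => h (infDist x Γ ^ 2) • f A x with hφ₀
    have hφ₀d : ContDiff ℝ 1 φ₀ := H.contDiff_cutoff_smul sqCutoff_contDiff (hmA.trans hAb) hz hm
      (H.contDiffAt A hA hAb)
    have hφ₀c : HasCompactSupport φ₀ := H.hasCompactSupport_cutoff_smul hz hm _
    have hφ₀n : ∀ x, ‖φ₀ x‖ ≤ 1 := by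
      intro x
      by_cases hx : infDist x Γ ≤ A
      · rw [hφ₀, norm_smul, Real.norm_of_nonneg (sqCutoff_nonneg _)]
        exact mul_le_one₀ (sqCutoff_le_one _) (norm_nonneg _) (H.norm_le_one hA hAb hx)
      · have : h (infDist x Γ ^ 2) = 0 := hz _ (by push Not at hx; gcongr; linarith)
        simp [hφ₀, this]
    have hφ₀τ : ∀ x ∈ tsupport ψ, ‖φ₀ x‖ ≤ 1 - τ := by
      intro x hx
      have hxr := hr x hx
      have h1 := H.norm_sq_le A hA hAb x (by linarith)
      have h0 := infDist_nonneg (x := x) (s := Γ)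
      have h2 : 2 * τ ≤ (A ^ 2 - infDist x Γ ^ 2) / (4 * A ^ 2) := by
        have : 2 * τ = (a ^ 2 - r ^ 2) / (4 * b ^ 2) := by rw [hτ]; field_simp; ring
        rw [this]
        apply div_le_div₀ <;> nlinarith
      have h3 : ‖f A x‖ ≤ 1 - τ := by
        apply le_of_sq_le_sq _ (by linarith)
        nlinarith
      rw [hφ₀, norm_smul, Real.norm_of_nonneg (sqCutoff_nonneg _)]
      exact (mul_le_of_le_one_left (norm_nonneg _) (sqCutoff_le_one _)).trans h3
    have hdiv : ∀ x ∈ S, divergence (fun z => φ₀ z + ε • ψ z) x =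
        ((d : ℝ) - 1) / A + ε * divergence ψ x := by
      intro x hx
      have hψx := hψ.differentiable one_ne_zero x
      rw [divergence_add (ψ := fun z => ε • ψ z) (hφ₀d.differentiable one_ne_zero x)
          (hψx.const_smul ε),
        divergence_const_smul ε hψx]
      have : φ₀ =ᶠ[𝓝 x] f A := by
        filter_upwards [(continuous_infDist_pt Γ).continuousAt.eventually_lt_const (hSa x hx)]
          with z hz
        have : h (infDist z Γ ^ 2) = 1 := sqCutoff_eq_one ha.le ham
          (by have := infDist_nonneg (x := z) (s := Γ); gcongr)
        rw [hφ₀]; simp [this]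
      rw [divergence_congr this, H.divergence_eq A hA hAb x ((hSa x hx).trans hab)]
    have hfield : IsPerimeterTestField fun z => φ₀ z + ε • ψ z := by
      refine ⟨hφ₀d.add (hψ.const_smul ε), hφ₀c.add (hψc.smul_left (f := fun _ => ε)), fun x => ?_⟩
      by_cases hx : x ∈ tsupport ψ
      · calc ‖φ₀ x + ε • ψ x‖ ≤ ‖φ₀ x‖ + ‖ε • ψ x‖ := norm_add_le _ _
          _ ≤ (1 - τ) + ε * M := by
            refine add_le_add (hφ₀τ x hx) ?_
            rw [norm_smul, Real.norm_of_nonneg hε0.le]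
            gcongr
            exact hM x
          _ ≤ 1 := by linarith
      · simpa [image_eq_zero_of_notMem_tsupport hx] using hφ₀n x
    refine le_trans (le_of_eq ?_) (le_iSup₂ (f := fun (φ : Euc d → Euc d)
      (_ : IsPerimeterTestField φ) => ENNReal.ofReal (∫ x in S, divergence φ x)) _ hfield)
    rw [setIntegral_congr_fun hS hdiv, integral_add
      (integrable_const_iff.2 (Or.inr ⟨by simpa using hfin⟩))
      ((integrable_divergence hψ hψc).integrableOn.const_mul ε), integral_const_mul]
    simp [mul_comm]
  have hlim : Tendsto (fun A => ENNReal.ofReal (((d : ℝ) - 1) / A * volume.real S +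
      ε * ∫ x in S, divergence ψ x)) (𝓝[>] a)
      (𝓝 (ENNReal.ofReal (((d : ℝ) - 1) / a * volume.real S +
      ε * ∫ x in S, divergence ψ x))) := by
    refine (ENNReal.continuous_ofReal.continuousAt.comp_of_eq (x := a) ?_ rfl).tendsto.mono_left
      nhdsWithin_le_nhds
    exact ((continuousAt_const.div continuousAt_id ha.ne').mul continuousAt_const).add
      continuousAt_const
  refine le_of_tendsto hlim ?_
  filter_upwards [Ioo_mem_nhdsGT hab] with A hA using key A hA.1 hA.2

/-- The calibration bounds the perimeter of the tube itself from above. -/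
theorem perimeter_tube_le (H : IsTubeCalibration Γ b y f) {a : ℝ} (hd : 2 ≤ d) (ha : 0 < a)
    (hab : a < b) :
    perimeter {x | infDist x Γ < a} ≤
      ENNReal.ofReal (((d : ℝ) - 1) / a * volume.real {x | infDist x Γ < a}) := by
  have hd' : (0 : ℝ) < (d : ℝ) - 1 := by
    have : (2 : ℝ) ≤ d := by exact_mod_cast hd
    linarith
  set Ω := {x | infDist x Γ < a} with hΩ
  have hΩo : IsOpen Ω := isOpen_lt (continuous_infDist_pt Γ) continuous_const
  have hfin : volume Ω < ⊤ := H.volume_lt_top fun x hx => hx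
  refine iSup₂_le fun φ hφ => ENNReal.ofReal_le_ofReal ?_
  obtain ⟨C, hC⟩ := H.inner_ge a ha hab
  have hφi := integrable_divergence hφ.contDiff hφ.hasCompactSupport
  -- No regularity of the boundary is needed. The field `φ - (1 + δ) f a` points inwards in a thin
  -- shell below radius `a`, so multiplying it by a radially decreasing cutoff produces a
  -- nonnegative gradient term, while the total divergence integrates to zero.
  have key : ∀ δ : ℝ, 0 < δ → ∀ᶠ r in 𝓝[<] a,
      ∫ x, sqCutoff r a (infDist x Γ ^ 2) * divergence φ x ≤
        (1 + δ) * (((d : ℝ) - 1) / a * volume.real Ω) := by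
    intro δ hδ
    -- By `inner_ge` this is a lower bound for `(1 + δ) ⟪f a x, y x⟫` on the shell of radii `[r,
    -- a]`. Its limit `(1 + δ) a` exceeds `a`, which bounds `⟪φ x, y x⟫` there.
    have hlim : Tendsto (fun r : ℝ => (1 + δ) * (r ^ 2 / a - |C| * (a ^ 2 - r ^ 2))) (𝓝 a)
        (𝓝 ((1 + δ) * (a ^ 2 / a - |C| * (a ^ 2 - a ^ 2)))) := by
      apply Continuous.tendsto
      fun_prop
    have hlt : a < (1 + δ) * (a ^ 2 / a - |C| * (a ^ 2 - a ^ 2)) := by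
      rw [sub_self, mul_zero, sub_zero, pow_two, mul_self_div_self]
      nlinarith
    filter_upwards [nhdsWithin_le_nhds (hlim.eventually_const_lt hlt), Ioo_mem_nhdsLT ha]
      with r hr hr0
    have hra : r < a := hr0.2
    have hr0 : 0 ≤ r := hr0.1.le
    set h := sqCutoff r a
    have hz : ∀ z, a ^ 2 ≤ z → h z = 0 := fun z hz => sqCutoff_eq_zero hr0 hra hz
    set g : Euc d → Euc d := fun x => φ x - (1 + δ) • f a x with hg
    have hgd : ∀ x, infDist x Γ < b → ContDiffAt ℝ 1 g x := fun x hx =>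
      hφ.contDiff.contDiffAt.sub ((H.contDiffAt a ha hab x hx).const_smul _)
    have hΦd : ContDiff ℝ 1 fun x => h (infDist x Γ ^ 2) • g x :=
      H.contDiff_cutoff_smul sqCutoff_contDiff hab hz ha.le hgd
    have hΦc : HasCompactSupport fun x => h (infDist x Γ ^ 2) • g x :=
      H.hasCompactSupport_cutoff_smul hz ha.le g
    have hηd : ContDiff ℝ 1 fun x => h (infDist x Γ ^ 2) • (1 : ℝ) :=
      H.contDiff_cutoff_smul sqCutoff_contDiff hab hz ha.le fun _ _ => contDiffAt_const
    have hηc : HasCompactSupport fun x => h (infDist x Γ ^ 2) • (1 : ℝ) :=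
      H.hasCompactSupport_cutoff_smul hz ha.le _
    simp only [smul_eq_mul, mul_one] at hηd hηc
    have hηi : Integrable fun x => h (infDist x Γ ^ 2) :=
      hηd.continuous.integrable_of_hasCompactSupport hηc
    have hηφi : Integrable fun x => h (infDist x Γ ^ 2) * divergence φ x :=
      (hηd.continuous.mul (continuous_divergence hφ.contDiff)).integrable_of_hasCompactSupport
        hηc.mul_right
    have h0 := integral_divergence_eq_zero hΦd hΦc
    have hpt : ∀ x, h (infDist x Γ ^ 2) * divergence φ x -
        (1 + δ) * (((d : ℝ) - 1) / a) * h (infDist x Γ ^ 2) ≤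
          divergence (fun x => h (infDist x Γ ^ 2) • g x) x := by
      intro x
      have hρ0 := infDist_nonneg (x := x) (s := Γ)
      by_cases hx : infDist x Γ < b
      · have hfx := (H.contDiffAt a ha hab x hx).differentiableAt one_ne_zero
        have hφx := hφ.contDiff.differentiable one_ne_zero x
        have e1 : divergence g x = divergence φ x - (1 + δ) * (((d : ℝ) - 1) / a) := by
          have := divergence_add (φ := φ) (ψ := fun z => (-(1 + δ)) • f a z) hφx
            (hfx.const_smul (-(1 + δ)))
          rw [divergence_const_smul _ hfx, H.divergence_eq a ha hab x hx] at this
          rw [show g = fun z => φ z + (-(1 + δ)) • f a z by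
            funext z; simp only [hg, neg_smul, sub_eq_add_neg], this]
          ring
        rw [divergence_smul (hηd.differentiable one_ne_zero x)
          ((hgd x hx).differentiableAt one_ne_zero), e1, H.fderiv_cutoff sqCutoff_contDiff hx]
        -- The derivative of the cutoff vanishes off the shell and is nonpositive on it, where the
        -- inner product is nonpositive by the choice of `r`.
        suffices 0 ≤ deriv h (infDist x Γ ^ 2) * (2 * inner ℝ (y x) (g x)) by linarith
        rcases lt_or_ge (infDist x Γ) r with hlt | hge
        · rw [deriv_sqCutoff_eq_zero hr0 hra (by gcongr)]; simp
        rcases lt_or_ge a (infDist x Γ) with hlt | hle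
        · rw [deriv_sqCutoff_eq_zero_of_ge hr0 hra (by gcongr)]; simp
        refine mul_nonneg_of_nonpos_of_nonpos (deriv_sqCutoff_nonpos hr0 hra _) ?_
        have i1 : inner ℝ (y x) (φ x) ≤ infDist x Γ := by
          refine (real_inner_le_norm _ _).trans ?_
          rw [H.norm_y x hx]
          exact mul_le_of_le_one_right hρ0 (hφ.norm_le_one x)
        have i2 : a ≤ (1 + δ) * inner ℝ (y x) (f a x) := by
          rw [real_inner_comm]
          refine hr.le.trans ?_
          gcongr
          refine le_trans ?_ (hC x hle)
          have : C * (a ^ 2 - infDist x Γ ^ 2) ≤ |C| * (a ^ 2 - r ^ 2) := by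
            apply mul_le_mul (le_abs_self C) _ (by nlinarith) (abs_nonneg C)
            nlinarith
          have : r ^ 2 / a ≤ infDist x Γ ^ 2 / a := by gcongr
          linarith
        rw [hg, inner_sub_right, inner_smul_right]
        linarith
      · have hlt : a < infDist x Γ := by linarith
        have e0 : h (infDist x Γ ^ 2) = 0 := hz _ (by gcongr)
        have : (fun x => h (infDist x Γ ^ 2) • g x) =ᶠ[𝓝 x] fun _ => 0 := by
          filter_upwards [(continuous_infDist_pt Γ).continuousAt.eventually_const_lt hlt]
            with z hz'
          rw [hz _ (by gcongr), zero_smul]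
        rw [divergence_congr this, e0]
        simp [divergence]
    have h1 := integral_mono (hηφi.sub (hηi.const_mul ((1 + δ) * (((d : ℝ) - 1) / a))))
      (integrable_divergence hΦd hΦc) hpt
    rw [h0] at h1
    simp only [Pi.sub_apply] at h1
    rw [integral_sub hηφi (hηi.const_mul _), integral_const_mul] at h1
    have h2 : ∫ x, h (infDist x Γ ^ 2) ≤ volume.real Ω := by
      have : ∫ x, Ω.indicator (fun _ => (1 : ℝ)) x = volume.real Ω := by
        rw [integral_indicator hΩo.measurableSet]; simp
      rw [← this]
      refine integral_mono hηi ?_ fun x => ?_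
      · exact (integrable_indicator_iff hΩo.measurableSet).2 (integrableOn_const hfin.ne)
      · by_cases hx : infDist x Γ < a
        · rw [indicator_of_mem (show x ∈ Ω from hx)]
          exact sqCutoff_le_one _
        · rw [indicator_of_notMem (show x ∉ Ω from hx)]
          exact (hz _ (by push Not at hx; gcongr)).le
    have h3 : (1 + δ) * (((d : ℝ) - 1) / a) * ∫ x, h (infDist x Γ ^ 2) ≤
        (1 + δ) * (((d : ℝ) - 1) / a) * volume.real Ω := by gcongr
    linarith
  -- As `r` increases to `a` the cutoffs converge pointwise to the indicator of the open tube.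
  have hlim : Tendsto (fun r => ∫ x, sqCutoff r a (infDist x Γ ^ 2) * divergence φ x) (𝓝[<] a)
      (𝓝 (∫ x in Ω, divergence φ x)) := by
    rw [← integral_indicator hΩo.measurableSet]
    refine tendsto_integral_filter_of_dominated_convergence (fun x => ‖divergence φ x‖) ?_ ?_
      hφi.norm ?_
    · refine Eventually.of_forall fun r => Continuous.aestronglyMeasurable ?_
      exact (sqCutoff_contDiff.continuous.comp ((continuous_infDist_pt Γ).pow 2)).mul
        (continuous_divergence hφ.contDiff)
    · refine Eventually.of_forall fun r => Eventually.of_forall fun x => ?_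
      rw [norm_mul, Real.norm_of_nonneg (sqCutoff_nonneg _)]
      exact mul_le_of_le_one_left (norm_nonneg _) (sqCutoff_le_one _)
    · refine Eventually.of_forall fun x => tendsto_const_nhds.congr' ?_
      have hρ0 := infDist_nonneg (x := x) (s := Γ)
      by_cases hx : infDist x Γ < a
      · filter_upwards [Ioo_mem_nhdsLT hx] with r hr
        rw [indicator_of_mem (show x ∈ Ω from hx), sqCutoff_eq_one (hρ0.trans hr.1.le) hr.2
          (by have := hr.1; gcongr), one_mul]
      · filter_upwards [Ioo_mem_nhdsLT ha] with r hr
        rw [indicator_of_notMem (show x ∉ Ω from hx), sqCutoff_eq_zero hr.1.le hr.2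
          (by push Not at hx; gcongr), zero_mul]
  have hall : ∀ δ : ℝ, 0 < δ →
      ∫ x in Ω, divergence φ x ≤ (1 + δ) * (((d : ℝ) - 1) / a * volume.real Ω) := fun δ hδ =>
    le_of_tendsto hlim (key δ hδ)
  have hlim2 : Tendsto (fun δ : ℝ => (1 + δ) * (((d : ℝ) - 1) / a * volume.real Ω)) (𝓝[>] 0)
      (𝓝 ((1 + 0) * (((d : ℝ) - 1) / a * volume.real Ω))) := by
    refine Tendsto.mono_left (Continuous.tendsto ?_ 0) nhdsWithin_le_nhds
    fun_prop
  rw [add_zero, one_mul] at hlim2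
  exact ge_of_tendsto hlim2 (by filter_upwards [self_mem_nhdsWithin] with δ hδ using hall δ hδ)

end IsTubeCalibration

/-! ### Sets without perimeter in a connected open set -/

section Constancy

open scoped Convolution

variable {d : ℕ}

theorem fderiv_normed_convolution_indicator {C : Set (Euc d)} (hC : MeasurableSet C)
    (φ : ContDiffBump (0 : Euc d)) (x v : Euc d) :
    DifferentiableAt ℝ (φ.normed volume ⋆[ContinuousLinearMap.lsmul ℝ ℝ, volume]
      C.indicator fun _ => (1 : ℝ)) x ∧
    fderiv ℝ (φ.normed volume ⋆[ContinuousLinearMap.lsmul ℝ ℝ, volume]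
      C.indicator fun _ => (1 : ℝ)) x v = ∫ t in C, fderiv ℝ (φ.normed volume) (x - t) v := by
  have hg : LocallyIntegrable (C.indicator fun _ => (1 : ℝ)) (volume : Measure (Euc d)) :=
    (locallyIntegrable_const 1).indicator hC
  have hφ : ContDiff ℝ 1 (φ.normed (volume : Measure (Euc d))) := φ.contDiff_normed
  rw [← convolution_flip]
  have h := φ.hasCompactSupport_normed.hasFDerivAt_convolution_right
    (ContinuousLinearMap.lsmul ℝ ℝ).flip hg hφ x
  refine ⟨h.differentiableAt, ?_⟩
  rw [h.fderiv, convolution_precompR_apply _ hg (φ.hasCompactSupport_normed.fderiv ℝ)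
    (hφ.continuous_fderiv one_ne_zero), convolution_def, ← integral_indicator hC]
  congr 1
  ext t
  by_cases ht : t ∈ C <;> simp [ht]

/-- Mollify the indicator of `C`. A directional derivative of the mollification at `z` is the
integral over `C` of the divergence of a translated, reflected bump times a constant vector, hence
zero. The mollifications are thus constant on the ball, and so is their almost everywhere limit, the
indicator. -/
theorem ae_const_ball_of_integral_divergence_eq_zero {C : Set (Euc d)}
    (hC : MeasurableSet C) {x₀ : Euc d} {r : ℝ} (hr : 0 < r)
    (h : ∀ ψ : Euc d → Euc d, ContDiff ℝ 1 ψ → HasCompactSupport ψ →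
      tsupport ψ ⊆ ball x₀ (2 * r) → ∫ x in C, divergence ψ x = 0) :
    volume (ball x₀ r ∩ C) = 0 ∨ volume (ball x₀ r \ C) = 0 := by
  set g : Euc d → ℝ := C.indicator fun _ => 1 with hg
  have hgl : LocallyIntegrable g (volume : Measure (Euc d)) :=
    (locallyIntegrable_const 1).indicator hC
  -- The outer radius is at most `r / 2`, so bumps centred in the ball of radius `r` are supported
  -- in the ball of radius `2r`. The fixed ratio `2` of outer to inner radius is what the almost
  -- everywhere convergence requires.
  let φ : ℕ → ContDiffBump (0 : Euc d) := fun n =>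
    ⟨r / (2 * (n + 2)), r / (n + 2), by positivity, by
      apply div_lt_div_of_pos_left hr (by positivity); linarith [(n.cast_nonneg : (0 : ℝ) ≤ n)]⟩
  have hφ0 : Tendsto (fun n => (φ n).rOut) atTop (𝓝 0) := by
    have := tendsto_natCast_atTop_atTop (R := ℝ)
    exact tendsto_const_nhds.div_atTop (tendsto_atTop_add_const_right _ _ this)
  have hconv := ContDiffBump.ae_convolution_tendsto_right_of_locallyIntegrable
    (μ := (volume : Measure (Euc d))) (K := 2) hφ0 (Eventually.of_forall fun n => by
      change r / ((n : ℝ) + 2) ≤ 2 * (r / (2 * (n + 2)))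
      apply le_of_eq; field_simp) hgl
  have hconst : ∀ n, ∀ x ∈ ball x₀ r, ∀ x' ∈ ball x₀ r,
      ((φ n).normed volume ⋆[ContinuousLinearMap.lsmul ℝ ℝ, volume] g) x =
      ((φ n).normed volume ⋆[ContinuousLinearMap.lsmul ℝ ℝ, volume] g) x' := by
    intro n x hx x' hx'
    refine isOpen_ball.is_const_of_fderiv_eq_zero (𝕜 := ℝ) (convex_ball x₀ r).isPreconnected
      (fun z _ => (fderiv_normed_convolution_indicator hC (φ n) z
        0).1.differentiableWithinAt) (fun z hz => ?_) hx hx'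
    ext v
    rw [(fderiv_normed_convolution_indicator hC (φ n) z v).2]
    have hφn : ContDiff ℝ 1 ((φ n).normed (volume : Measure (Euc d))) := (φ n).contDiff_normed
    -- The sign compensates for differentiating in `t` instead of `z`.
    have hθ : ContDiff ℝ 1 fun t => -(φ n).normed volume (z - t) :=
      (hφn.comp (contDiff_const.sub contDiff_id)).neg
    have hsupp : ∀ t, t ∉ closedBall z (r / 2) → -(φ n).normed volume (z - t) = 0 := by
      intro t ht
      rw [neg_eq_zero]
      refine image_eq_zero_of_notMem_tsupport fun hmem => ht ?_
      rw [(φ n).tsupport_normed_eq, mem_closedBall_zero_iff, ← dist_eq_norm] at hmem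
      rw [mem_closedBall, dist_comm]
      refine hmem.trans ?_
      change r / ((n : ℝ) + 2) ≤ r / 2
      gcongr
      linarith [(n.cast_nonneg : (0 : ℝ) ≤ n)]
    have hψs : ∀ t, t ∉ closedBall z (r / 2) → (-(φ n).normed volume (z - t)) • v = 0 :=
      fun t ht => by rw [hsupp t ht, zero_smul]
    have hψ := h (fun t => (-(φ n).normed volume (z - t)) • v) (hθ.smul contDiff_const)
      (HasCompactSupport.intro (isCompact_closedBall z (r / 2)) hψs) (by
        have : tsupport (fun t => (-(φ n).normed volume (z - t)) • v) ⊆ closedBall z (r / 2) :=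
          closure_minimal (fun t ht => by_contra fun hc => ht (hψs t hc)) isClosed_closedBall
        refine this.trans fun t ht => ?_
        have h1 : dist t z ≤ r / 2 := ht
        have h2 : dist z x₀ < r := hz
        exact mem_ball.2 (by linarith [dist_triangle t z x₀]))
    simp only [Pi.zero_apply, _root_.zero_apply]
    rw [← hψ]
    congr 1
    ext t
    rw [divergence_smul_const v (hθ.differentiable one_ne_zero t)]
    have h1 := ((hφn.differentiable one_ne_zero (z - t)).hasFDerivAt.comp t
      ((hasFDerivAt_const z t).sub (hasFDerivAt_id t))).neg
    have h2 : fderiv ℝ (fun t => -(φ n).normed volume (z - t)) t = _ := h1.fderiv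
    rw [h2]
    simp
  by_contra hcon
  push Not at hcon
  have hex : ∀ T : Set (Euc d), volume T ≠ 0 → ∃ x ∈ T,
      Tendsto (fun n => ((φ n).normed volume ⋆[ContinuousLinearMap.lsmul ℝ ℝ, volume] g) x)
        atTop (𝓝 (g x)) := by
    intro T hT
    by_contra hno
    push Not at hno
    refine hT (measure_mono_null ?_ (ae_iff.1 hconv))
    exact fun x hx => hno x hx
  obtain ⟨x, ⟨hxb, hxC⟩, hx⟩ := hex _ hcon.1
  obtain ⟨x', ⟨hxb', hxC'⟩, hx'⟩ := hex _ hcon.2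
  have := tendsto_nhds_unique (hx.congr fun n => hconst n x hxb x' hxb') hx'
  simp [hg, hxC, hxC'] at this

/-- A set without perimeter in a connected open set either contains almost all of it or is
negligible in it. -/
theorem ae_const_of_integral_divergence_eq_zero {C U : Set (Euc d)} (hU : IsOpen U)
    (hUc : IsPreconnected U) (hC : MeasurableSet C)
    (h : ∀ ψ : Euc d → Euc d, ContDiff ℝ 1 ψ → HasCompactSupport ψ →
      tsupport ψ ⊆ U → ∫ x in C, divergence ψ x = 0) :
    volume (U ∩ C) = 0 ∨ volume (U \ C) = 0 := by
  set P : Set (Euc d) := {x | ∃ r, 0 < r ∧ volume (ball x r ∩ C) = 0} with hP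
  set Q : Set (Euc d) := {x | ∃ r, 0 < r ∧ volume (ball x r \ C) = 0} with hQ
  have hopen : ∀ T : Set (Euc d), IsOpen {x | ∃ r, 0 < r ∧ volume (ball x r ∩ T) = 0} := by
    intro T
    refine isOpen_iff.2 fun x ⟨r, hr, hx⟩ => ⟨r / 2, by positivity, fun z hz => ?_⟩
    refine ⟨r / 2, by positivity, measure_mono_null (inter_subset_inter_left T ?_) hx⟩
    intro w hw
    rw [mem_ball] at *
    linarith [dist_triangle w z x]
  have hPo : IsOpen P := hopen C
  have hQo : IsOpen Q := hopen Cᶜ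
  have hcov : U ⊆ P ∪ Q := by
    intro x hx
    obtain ⟨ε, hε, hεU⟩ := isOpen_iff.1 hU x hx
    rcases ae_const_ball_of_integral_divergence_eq_zero hC (x₀ := x) (r := ε / 2) (by positivity)
      (fun ψ h1 h2 h3 => h ψ h1 h2 (h3.trans (by rwa [mul_div_cancel₀ ε two_ne_zero])))
      with h1 | h1
    · exact Or.inl ⟨_, half_pos hε, h1⟩
    · exact Or.inr ⟨_, half_pos hε, h1⟩
  have hdisj : P ∩ Q = ∅ := by
    refine eq_empty_of_forall_notMem fun x ⟨⟨r, hr, hx⟩, ⟨s, hs, hx'⟩⟩ => ?_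
    have hpos : 0 < volume (ball x (min r s)) := measure_ball_pos _ _ (lt_min hr hs)
    refine hpos.ne' (measure_mono_null ?_ (measure_union_null hx hx'))
    intro z hz
    have h1 : z ∈ ball x r := ball_subset_ball (min_le_left _ _) hz
    have h2 : z ∈ ball x s := ball_subset_ball (min_le_right _ _) hz
    by_cases hzC : z ∈ C
    · exact Or.inl ⟨h1, hzC⟩
    · exact Or.inr ⟨h2, hzC⟩
  have hnull : ∀ T : Set (Euc d), U ⊆ {x | ∃ r, 0 < r ∧ volume (ball x r ∩ T) = 0} →
      volume (U ∩ T) = 0 := by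
    intro T hT
    refine measure_null_of_locally_null _ fun x hx => ?_
    obtain ⟨r, hr, h0⟩ := hT hx.1
    refine ⟨_, inter_mem_nhdsWithin (U ∩ T) (ball_mem_nhds x hr), measure_mono_null ?_ h0⟩
    exact fun z hz => ⟨hz.2, hz.1.2⟩
  by_cases h1 : (U ∩ P).Nonempty
  · by_cases h2 : (U ∩ Q).Nonempty
    · obtain ⟨z, -, hz⟩ := hUc P Q hPo hQo hcov h1 h2
      rw [hdisj] at hz
      exact hz.elim
    · refine Or.inl (hnull C fun x hx => (hcov hx).resolve_right fun hxQ => h2 ⟨x, hx, hxQ⟩)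
  · exact Or.inr (hnull Cᶜ fun x hx => (hcov hx).resolve_left fun hxP => h1 ⟨x, hx, hxP⟩)

end Constancy

/-! ### Connectedness of the tube, and the Cheeger problem of a calibrated tube -/

theorem isPreconnected_setOf_infDist_lt {d : ℕ} {Γ : Set (Euc d)} (hΓ : IsCompact Γ)
    (hne : Γ.Nonempty) (hc : IsPreconnected Γ) {a : ℝ} (ha : 0 < a) :
    IsPreconnected {x | infDist x Γ < a} := by
  have hΓs : Γ ⊆ {x | infDist x Γ < a} := fun x hx => by simpa [infDist_zero_of_mem hx] using ha
  obtain ⟨p, hp⟩ := hne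
  refine isPreconnected_of_forall p fun x hx => ?_
  obtain ⟨q, hq, hxq⟩ := hΓ.exists_infDist_eq_dist ⟨p, hp⟩ x
  refine ⟨Γ ∪ ball q a, union_subset hΓs fun z hz => ?_, Or.inl hp, Or.inr ?_, ?_⟩
  · exact (infDist_le_dist_of_mem hq).trans_lt hz
  · rw [mem_ball, ← hxq]; exact hx
  · exact hc.union q hq (mem_ball_self ha) (convex_ball q a).isPreconnected

namespace IsTubeCalibration

variable {d : ℕ} {Γ : Set (Euc d)} {b : ℝ} {y : Euc d → Euc d} {f : ℝ → Euc d → Euc d}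

theorem le_perimeter (H : IsTubeCalibration Γ b y f) {a : ℝ} (ha : 0 < a) (hab : a < b)
    {S : Set (Euc d)} (hS : MeasurableSet S) (hSa : ∀ x ∈ S, infDist x Γ < a) :
    ENNReal.ofReal (((d : ℝ) - 1) / a) * volume S ≤ perimeter S := by
  obtain ⟨ε, -, h⟩ := H.exists_le_perimeter ha hab (ψ := fun _ => 0) contDiff_const
    HasCompactSupport.zero (by simp [tsupport])
  have := h S hS hSa
  have h0 : ∀ x, divergence (fun _ : Euc d => (0 : Euc d)) x = 0 := fun x => by simp [divergence]
  simp only [h0, integral_zero, mul_zero, add_zero] at this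
  rwa [ENNReal.ofReal_mul' measureReal_nonneg,
    ofReal_measureReal (H.volume_lt_top hSa).ne] at this

/-- The two perimeter bounds give the value and the minimality of the tube. For another minimiser
the lower bound is an equality, so its perturbed form forces `∫ div ψ ≤ 0` for all `ψ` supported in
the tube. Replacing `ψ` by `-ψ` gives equality to zero, and connectedness concludes. -/
theorem isCheegerSet (H : IsTubeCalibration Γ b y f) (hc : IsPreconnected Γ) (hd : 2 ≤ d)
    {a : ℝ} (ha : 0 < a) (hab : a < b) :
    cheegerConstant {x | infDist x Γ < a} = ENNReal.ofReal (((d : ℝ) - 1) / a) ∧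
      IsCheegerSet {x | infDist x Γ < a} {x | infDist x Γ < a} ∧
      ∀ C, IsCheegerSet {x | infDist x Γ < a} C → C =ᵐ[volume] {x | infDist x Γ < a} := by
  set Ω := {x | infDist x Γ < a} with hΩ
  have hΩo : IsOpen Ω := isOpen_lt (continuous_infDist_pt Γ) continuous_const
  have hfin : ∀ {S : Set (Euc d)}, S ⊆ Ω → volume S ≠ ⊤ := fun hS =>
    (H.volume_lt_top (a := a) fun x hx => hS hx).ne
  obtain ⟨p, hp⟩ := H.nonempty
  have hpΩ : p ∈ Ω := by simpa [hΩ, infDist_zero_of_mem hp] using ha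
  have hpos : 0 < volume Ω := hΩo.measure_pos _ ⟨p, hpΩ⟩
  have hcomp : IsCheegerCompetitor Ω Ω := ⟨subset_rfl, hΩo.measurableSet,
    (H.isCompact_le a).isBounded.subset fun x hx => mem_ofPred.2 (le_of_lt hx), hpos⟩
  have hlow : ENNReal.ofReal (((d : ℝ) - 1) / a) ≤ cheegerConstant Ω := by
    refine le_iInf₂ fun S hS => ?_
    rw [ENNReal.le_div_iff_mul_le (Or.inl hS.volume_pos.ne') (Or.inl (hfin hS.subset))]
    exact H.le_perimeter ha hab hS.measurableSet fun x hx => hS.subset hx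
  have hup : perimeter Ω / volume Ω ≤ ENNReal.ofReal (((d : ℝ) - 1) / a) := by
    refine ENNReal.div_le_of_le_mul ?_
    have := H.perimeter_tube_le hd ha hab
    rwa [ENNReal.ofReal_mul' measureReal_nonneg, ofReal_measureReal (hfin subset_rfl)] at this
  have hle : cheegerConstant Ω ≤ perimeter Ω / volume Ω := iInf₂_le Ω hcomp
  have heq : cheegerConstant Ω = ENNReal.ofReal (((d : ℝ) - 1) / a) :=
    le_antisymm (hle.trans hup) hlow
  refine ⟨heq, ⟨hcomp, le_antisymm (hup.trans hlow) hle⟩, fun C hC => ?_⟩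
  have hd' : (0 : ℝ) ≤ ((d : ℝ) - 1) / a := by
    have : (2 : ℝ) ≤ d := by exact_mod_cast hd
    exact div_nonneg (by linarith) ha.le
  have hCs := hC.competitor.subset
  have hper : perimeter C = ENNReal.ofReal (((d : ℝ) - 1) / a * volume.real C) := by
    rw [ENNReal.ofReal_mul' measureReal_nonneg, ofReal_measureReal (hfin hCs),
      ← heq, ← hC.minimal, ENNReal.div_mul_cancel hC.competitor.volume_pos.ne' (hfin hCs)]
  have hnonpos : ∀ ψ : Euc d → Euc d, ContDiff ℝ 1 ψ → HasCompactSupport ψ →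
      tsupport ψ ⊆ Ω → ∫ x in C, divergence ψ x ≤ 0 := by
    intro ψ h1 h2 h3
    obtain ⟨ε, hε, h⟩ := H.exists_le_perimeter ha hab h1 h2 fun x hx => h3 hx
    have := h C hC.competitor.measurableSet fun x hx => hCs hx
    rw [hper, ENNReal.ofReal_le_ofReal_iff (by positivity)] at this
    by_contra hcon
    push Not at hcon
    nlinarith [mul_pos hε hcon]
  have hzero : ∀ ψ : Euc d → Euc d, ContDiff ℝ 1 ψ → HasCompactSupport ψ →
      tsupport ψ ⊆ Ω → ∫ x in C, divergence ψ x = 0 := by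
    intro ψ h1 h2 h3
    refine le_antisymm (hnonpos ψ h1 h2 h3) ?_
    have hn := hnonpos (fun x => (-1 : ℝ) • ψ x) (h1.const_smul _)
      (h2.smul_left (f := fun _ => (-1 : ℝ)))
      ((tsupport_smul_subset_right (fun _ => (-1 : ℝ)) ψ).trans h3)
    have : ∀ x, divergence (fun x => (-1 : ℝ) • ψ x) x = -divergence ψ x := fun x => by
      rw [divergence_const_smul _ (h1.differentiable one_ne_zero x)]; ring
    simp only [this, integral_neg] at hn
    linarith
  rcases ae_const_of_integral_divergence_eq_zero hΩo
    (isPreconnected_setOf_infDist_lt H.isCompact H.nonempty hc ha) hC.competitor.measurableSet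
    hzero with h | h
  · rw [inter_eq_self_of_subset_right hCs] at h
    exact absurd h hC.competitor.volume_pos.ne'
  · exact hCs.eventuallyLE.antisymm (ae_le_set.2 h)

end IsTubeCalibration

/-! ### Feet of perpendiculars, by the implicit function theorem -/

section Foot

variable {d : ℕ} {c : ℝ → Euc d}

/-- Minus the derivative of `s ↦ ⟪x - c s, c' s⟫`, equal to the squared speed times the Jacobian
of the normal coordinates. -/
noncomputable def footJacobian (c : ℝ → Euc d) (x : Euc d) (s : ℝ) : ℝ :=
  ‖deriv c s‖ ^ 2 - inner ℝ (x - c s) (deriv (deriv c) s)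

theorem contDiff_deriv_of_contDiff_infty {E : Type*} [NormedAddCommGroup E] [NormedSpace ℝ E]
    {c : ℝ → E} (hc : ContDiff ℝ ∞ c) : ContDiff ℝ ∞ (deriv c) :=
  (contDiff_infty_iff_deriv.1 hc).2

theorem hasDerivAt_of_contDiff_infty {E : Type*} [NormedAddCommGroup E] [NormedSpace ℝ E]
    {c : ℝ → E} (hc : ContDiff ℝ ∞ c) (s : ℝ) : HasDerivAt c (deriv c s) s :=
  (hc.differentiable (by simp) s).hasDerivAt

theorem hasFDerivAt_inner_sub_deriv (hc : ContDiff ℝ ∞ c) (u : Euc d × ℝ) :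
    HasFDerivAt (fun v : Euc d × ℝ => inner ℝ (v.1 - c v.2) (deriv c v.2))
      ((innerSL ℝ (deriv c u.2)).comp (ContinuousLinearMap.fst ℝ (Euc d) ℝ) -
        footJacobian c u.1 u.2 • ContinuousLinearMap.snd ℝ (Euc d) ℝ) u := by
  have h1 := HasFDerivAt.comp (g := c) u (hasDerivAt_of_contDiff_infty hc u.2).hasFDerivAt
    (hasFDerivAt_snd (𝕜 := ℝ) (E := Euc d))
  have h2 := HasFDerivAt.comp (g := deriv c) u
    (hasDerivAt_of_contDiff_infty (contDiff_deriv_of_contDiff_infty hc) u.2).hasFDerivAt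
    (hasFDerivAt_snd (𝕜 := ℝ) (E := Euc d))
  have h3 := ((hasFDerivAt_fst (p := u)).sub h1).inner ℝ h2
  refine HasFDerivAt.congr_fderiv
    (f := fun v : Euc d × ℝ => inner ℝ (v.1 - c v.2) (deriv c v.2)) h3 ?_
  ext v
  · simp [real_inner_comm, fderivInnerCLM_apply]
  · simp [footJacobian, fderivInnerCLM_apply]
    ring

/-- The implicit function theorem solves `⟪x - c s, deriv c s⟫ = 0` for `s`, since the
`s`-derivative of the left side is minus `footJacobian`. The fourth clause is local uniqueness of
the solution, used to identify other feet with `σ`. -/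
theorem exists_local_foot (hc : ContDiff ℝ ∞ c) {x₀ : Euc d} {s₀ : ℝ}
    (h0 : inner ℝ (x₀ - c s₀) (deriv c s₀) = 0) (hD : footJacobian c x₀ s₀ ≠ 0) :
    ∃ σ : Euc d → ℝ, ContDiffAt ℝ 1 σ x₀ ∧ σ x₀ = s₀ ∧
      (∀ᶠ x in 𝓝 x₀, inner ℝ (x - c (σ x)) (deriv c (σ x)) = 0) ∧
      (∀ᶠ v : Euc d × ℝ in 𝓝 (x₀, s₀), inner ℝ (v.1 - c v.2) (deriv c v.2) = 0 → σ v.1 = v.2) ∧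
      ∀ v, fderiv ℝ σ x₀ v = inner ℝ (deriv c s₀) v / footJacobian c x₀ s₀ := by
  set F : Euc d × ℝ → ℝ := fun v => inner ℝ (v.1 - c v.2) (deriv c v.2) with hF
  have hc1 : ContDiff ℝ 1 c := hc.of_le (by simp)
  have hc2 : ContDiff ℝ 1 (deriv c) := (contDiff_deriv_of_contDiff_infty hc).of_le (by simp)
  have cdf : ContDiffAt ℝ 1 F (x₀, s₀) := by
    refine ContDiff.contDiffAt (ContDiff.inner ℝ (contDiff_fst.sub (hc1.comp contDiff_snd))
      (hc2.comp contDiff_snd))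
  have hfd : fderiv ℝ F (x₀, s₀) = _ := (hasFDerivAt_inner_sub_deriv hc (x₀, s₀)).fderiv
  have hinv : (fderiv ℝ F (x₀, s₀) ∘L .inr ℝ (Euc d) ℝ).IsInvertible := by
    refine ContinuousLinearMap.IsInvertible.of_inverse
      (g := (-(footJacobian c x₀ s₀)⁻¹) • ContinuousLinearMap.id ℝ ℝ) ?_ ?_
    · rw [hfd]; ext; simp [hD]
    · rw [hfd]; ext; simp [hD]
  refine ⟨cdf.implicitFunction one_ne_zero hinv, cdf.contDiffAt_implicitFunction one_ne_zero hinv,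
    cdf.implicitFunction_apply_self one_ne_zero hinv, ?_, ?_, fun v => ?_⟩
  · filter_upwards [cdf.eventually_apply_implicitFunction one_ne_zero hinv] with x hx
    exact hx.trans h0
  · filter_upwards [cdf.eventually_apply_eq_iff_implicitFunction one_ne_zero hinv] with x hx h
    exact hx.1 (h.trans h0.symm)
  · set σ := cdf.implicitFunction one_ne_zero hinv
    have hσ0 : σ x₀ = s₀ := cdf.implicitFunction_apply_self one_ne_zero hinv
    have hσ := ((cdf.contDiffAt_implicitFunction one_ne_zero hinv).differentiableAt
      one_ne_zero).hasFDerivAt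
    have hu : HasFDerivAt (fun x => (x, σ x)) _ x₀ := (hasFDerivAt_id x₀).prodMk hσ
    have h1 := (hasFDerivAt_inner_sub_deriv hc (x₀, σ x₀)).comp x₀ hu
    have h2 : HasFDerivAt (F ∘ fun x => (x, σ x)) (0 : Euc d →L[ℝ] ℝ) x₀ := by
      refine (hasFDerivAt_const (F (x₀, s₀)) x₀).congr_of_eventuallyEq ?_
      filter_upwards [cdf.eventually_apply_implicitFunction one_ne_zero hinv] with x hx using hx
    have h3 := DFunLike.congr_fun (h1.unique h2) v
    simp only [hσ0] at h3
    simp at h3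
    rw [eq_div_iff hD]
    linarith

end Foot

/-! ### Curvature vector and the calibrating field -/

section Curvature

variable {d : ℕ} {c : ℝ → Euc d}

/-- The curvature vector of a regular curve with arbitrary parametrisation. -/
noncomputable def curvatureVector (c : ℝ → Euc d) (s : ℝ) : Euc d :=
  (‖deriv c s‖ ^ 2)⁻¹ • (deriv (deriv c) s -
    (inner ℝ (deriv (deriv c) s) (deriv c s) * (‖deriv c s‖ ^ 2)⁻¹) • deriv c s)

theorem inner_curvatureVector_deriv (hreg : ∀ s, deriv c s ≠ 0) (s : ℝ) :
    inner ℝ (curvatureVector c s) (deriv c s) = 0 := by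
  have h : ‖deriv c s‖ ≠ 0 := norm_ne_zero_iff.2 (hreg s)
  rw [curvatureVector, inner_smul_left, inner_sub_left, inner_smul_left,
    real_inner_self_eq_norm_sq]
  simp only [conj_trivial]
  field_simp
  ring

theorem inner_curvatureVector_of_normal (hreg : ∀ s, deriv c s ≠ 0) {s : ℝ} {y : Euc d}
    (hy : inner ℝ y (deriv c s) = 0) :
    ‖deriv c s‖ ^ 2 * inner ℝ (curvatureVector c s) y = inner ℝ y (deriv (deriv c) s) := by
  have h : ‖deriv c s‖ ≠ 0 := norm_ne_zero_iff.2 (hreg s)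
  rw [curvatureVector, inner_smul_left, inner_sub_left, inner_smul_left,
    real_inner_comm y (deriv c s), hy, real_inner_comm y]
  simp only [conj_trivial]
  field_simp
  ring

theorem footJacobian_eq (hreg : ∀ s, deriv c s ≠ 0) {x : Euc d} {s : ℝ}
    (h : inner ℝ (x - c s) (deriv c s) = 0) :
    footJacobian c x s = ‖deriv c s‖ ^ 2 * (1 - inner ℝ (curvatureVector c s) (x - c s)) := by
  rw [mul_sub, inner_curvatureVector_of_normal hreg h, footJacobian, mul_one]

theorem contDiff_curvatureVector (hc : ContDiff ℝ ∞ c) (hreg : ∀ s, deriv c s ≠ 0) :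
    ContDiff ℝ ∞ (curvatureVector c) := by
  have h1 := contDiff_deriv_of_contDiff_infty hc
  have h2 := contDiff_deriv_of_contDiff_infty h1
  have h3 : ContDiff ℝ ∞ fun s => (‖deriv c s‖ ^ 2)⁻¹ :=
    (h1.norm_sq ℝ).inv fun s => pow_ne_zero 2 (norm_ne_zero_iff.2 (hreg s))
  exact h3.smul (h2.sub (((h2.inner ℝ h1).mul h3).smul h1))

/-- Differentiate `⟪κ, c'⟫ = 0` and use `⟪κ, c''⟫ = ‖c'‖² ‖κ‖²`. -/
theorem inner_deriv_curvatureVector (hc : ContDiff ℝ ∞ c) (hreg : ∀ s, deriv c s ≠ 0) (s : ℝ) :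
    inner ℝ (deriv c s) (deriv (curvatureVector c) s) =
      -(‖deriv c s‖ ^ 2 * ‖curvatureVector c s‖ ^ 2) := by
  have h1 := (hasDerivAt_of_contDiff_infty (contDiff_curvatureVector hc hreg) s).inner ℝ
    (hasDerivAt_of_contDiff_infty (contDiff_deriv_of_contDiff_infty hc) s)
  have h2 : HasDerivAt (fun t => inner ℝ (curvatureVector c t) (deriv c t)) 0 s := by
    simp only [inner_curvatureVector_deriv hreg]
    exact hasDerivAt_const s 0
  have h3 := h1.unique h2
  rw [← inner_curvatureVector_of_normal hreg (inner_curvatureVector_deriv hreg s),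
    real_inner_self_eq_norm_sq] at h3
  rw [real_inner_comm]
  linarith

/-- The calibrating field of the tube of radius `A`, at the point `x` with foot `c s`. -/
noncomputable def footField (c : ℝ → Euc d) (A s : ℝ) (x : Euc d) : Euc d :=
  A⁻¹ • (x - c s) + (-((A ^ 2 - ‖x - c s‖ ^ 2) /
    (2 * A * (1 - inner ℝ (curvatureVector c s) (x - c s))))) • curvatureVector c s

variable {x₀ : Euc d} {σ : Euc d → ℝ}

theorem contDiffAt_sub_comp (hc : ContDiff ℝ ∞ c) (hσ : ContDiffAt ℝ 1 σ x₀) :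
    ContDiffAt ℝ 1 (fun x => x - c (σ x)) x₀ :=
  contDiffAt_id.sub ((hc.of_le (by simp)).contDiffAt.comp x₀ hσ)

theorem hasFDerivAt_sub_comp (hc : ContDiff ℝ ∞ c) (hσ : ContDiffAt ℝ 1 σ x₀) :
    HasFDerivAt (fun x => x - c (σ x)) (ContinuousLinearMap.id ℝ (Euc d) -
      (fderiv ℝ σ x₀).smulRight (deriv c (σ x₀))) x₀ := by
  have h := (hasFDerivAt_id x₀).sub ((hasDerivAt_of_contDiff_infty hc (σ x₀)).hasFDerivAt.comp x₀
    (hσ.differentiableAt one_ne_zero).hasFDerivAt)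
  refine HasFDerivAt.congr_fderiv (f := fun x => x - c (σ x)) h ?_
  ext v
  simp

/-- The motion of the foot is tangential, hence orthogonal to `x₀ - c (σ x₀)`, and contributes
nothing. -/
theorem hasFDerivAt_norm_sq_sub_comp (hc : ContDiff ℝ ∞ c) (hσ : ContDiffAt ℝ 1 σ x₀)
    (h0 : inner ℝ (x₀ - c (σ x₀)) (deriv c (σ x₀)) = 0) :
    HasFDerivAt (fun x => ‖x - c (σ x)‖ ^ 2) ((2 : ℝ) • innerSL ℝ (x₀ - c (σ x₀))) x₀ := by
  refine (hasFDerivAt_sub_comp hc hσ).norm_sq.congr_fderiv ?_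
  ext v
  rw [inner_sub_left] at h0
  simp
  linear_combination (fderiv ℝ σ x₀ v) * h0

theorem contDiffAt_footField (hc : ContDiff ℝ ∞ c) (hreg : ∀ s, deriv c s ≠ 0) {A : ℝ}
    (hA : A ≠ 0) (hσ : ContDiffAt ℝ 1 σ x₀)
    (hu : inner ℝ (curvatureVector c (σ x₀)) (x₀ - c (σ x₀)) ≠ 1) :
    ContDiffAt ℝ 1 (fun x => footField c A (σ x) x) x₀ := by
  have hy := contDiffAt_sub_comp hc hσ
  have hκ : ContDiffAt ℝ 1 (fun x => curvatureVector c (σ x)) x₀ :=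
    ((contDiff_curvatureVector hc hreg).of_le (by simp)).contDiffAt.comp x₀ hσ
  refine (hy.const_smul _).add (ContDiffAt.smul (ContDiffAt.neg (ContDiffAt.div ?_ ?_ ?_)) hκ)
  · exact contDiffAt_const.sub (hy.norm_sq ℝ)
  · exact contDiffAt_const.mul (contDiffAt_const.sub (hκ.inner ℝ hy))
  · exact mul_ne_zero (by simpa using hA) (sub_ne_zero.2 hu.symm)

/-- With `u = ⟪κ, y⟫`, one has `div y = d - 1/(1 - u)` and `div κ = -‖κ‖²/(1 - u)`. The coefficient
`g` of `κ` is such that the `‖κ‖²` terms of `g div κ` and of its derivative along `κ` cancel. What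
remains, `u/(A(1 - u))`, is exactly the defect of `div (y/A)` from `(d - 1)/A`. -/
theorem divergence_footField (hc : ContDiff ℝ ∞ c) (hreg : ∀ s, deriv c s ≠ 0) {A : ℝ}
    (hA : A ≠ 0) (hσ : ContDiffAt ℝ 1 σ x₀)
    (h0 : inner ℝ (x₀ - c (σ x₀)) (deriv c (σ x₀)) = 0)
    (hu : inner ℝ (curvatureVector c (σ x₀)) (x₀ - c (σ x₀)) ≠ 1)
    (hσ' : ∀ v, fderiv ℝ σ x₀ v = inner ℝ (deriv c (σ x₀)) v / footJacobian c x₀ (σ x₀)) :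
    divergence (fun x => footField c A (σ x) x) x₀ = ((d : ℝ) - 1) / A := by
  set s := σ x₀ with hs
  set κ := curvatureVector c s with hκdef
  set u := inner ℝ κ (x₀ - c s) with hudef
  set w := ‖x₀ - c s‖ ^ 2 with hwdef
  have hT : ‖deriv c s‖ ≠ 0 := norm_ne_zero_iff.2 (hreg s)
  have hJ : footJacobian c x₀ s = ‖deriv c s‖ ^ 2 * (1 - u) := footJacobian_eq hreg h0
  have hu1 : 1 - u ≠ 0 := sub_ne_zero.2 hu.symm
  have hy := contDiffAt_sub_comp hc hσ
  have hκ : ContDiffAt ℝ 1 (fun x => curvatureVector c (σ x)) x₀ :=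
    ((contDiff_curvatureVector hc hreg).of_le (by simp)).contDiffAt.comp x₀ hσ
  have hyd := hy.differentiableAt one_ne_zero
  have hκd := hκ.differentiableAt one_ne_zero
  have hg : ContDiffAt ℝ 1 (fun x => -((A ^ 2 - ‖x - c (σ x)‖ ^ 2) /
      (2 * A * (1 - inner ℝ (curvatureVector c (σ x)) (x - c (σ x)))))) x₀ := by
    refine ContDiffAt.neg (ContDiffAt.div ?_ ?_ ?_)
    · exact contDiffAt_const.sub (hy.norm_sq ℝ)
    · exact contDiffAt_const.mul (contDiffAt_const.sub (hκ.inner ℝ hy))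
    · exact mul_ne_zero (by simpa using hA) hu1
  have hgd := hg.differentiableAt one_ne_zero
  have hκf : HasFDerivAt (fun x => curvatureVector c (σ x))
      ((fderiv ℝ σ x₀).smulRight (deriv (curvatureVector c) s)) x₀ := by
    have h := (hasDerivAt_of_contDiff_infty (contDiff_curvatureVector hc hreg)
      (σ x₀)).hasFDerivAt.comp x₀ (hσ.differentiableAt one_ne_zero).hasFDerivAt
    refine HasFDerivAt.congr_fderiv (f := fun x => curvatureVector c (σ x)) h ?_
    ext v
    simp [hs]
  have hσT : fderiv ℝ σ x₀ (deriv c s) = (1 - u)⁻¹ := by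
    rw [hσ', real_inner_self_eq_norm_sq, hJ]
    field_simp
  -- The foot does not move when `x` moves along a normal direction.
  have hσκ : fderiv ℝ σ x₀ κ = 0 := by
    rw [hσ', real_inner_comm, inner_curvatureVector_deriv hreg, zero_div]
  have hσκ' : fderiv ℝ σ x₀ (deriv (curvatureVector c) s) = -(‖κ‖ ^ 2 * (1 - u)⁻¹) := by
    rw [hσ', inner_deriv_curvatureVector hc hreg, hJ, ← hκdef]
    field_simp
  have e1 : divergence (fun x => x - c (σ x)) x₀ = d - (1 - u)⁻¹ := by
    rw [divergence_eq_of_hasFDerivAt (hasFDerivAt_sub_comp hc hσ), ← hσT,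
      ← sum_apply_single_mul (fderiv ℝ σ x₀) (deriv c s)]
    simp [Finset.sum_sub_distrib, hs]
  have e2 : divergence (fun x => curvatureVector c (σ x)) x₀ = -(‖κ‖ ^ 2 * (1 - u)⁻¹) := by
    rw [divergence_eq_of_hasFDerivAt hκf, ← hσκ',
      ← sum_apply_single_mul (fderiv ℝ σ x₀) (deriv (curvatureVector c) s)]
    simp
  have e3 : fderiv ℝ (fun x => -((A ^ 2 - ‖x - c (σ x)‖ ^ 2) /
      (2 * A * (1 - inner ℝ (curvatureVector c (σ x)) (x - c (σ x)))))) x₀ κ =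
      u / (A * (1 - u)) - (A ^ 2 - w) * ‖κ‖ ^ 2 / (2 * A * (1 - u) ^ 2) := by
    have hline : HasDerivAt (fun t : ℝ => x₀ + t • κ) κ 0 := by
      simpa using ((hasDerivAt_id (0 : ℝ)).smul_const κ).const_add x₀
    have hl0 : x₀ + (0 : ℝ) • κ = x₀ := by simp
    have l1 := (HasFDerivAt.comp_hasDerivAt (f := fun t : ℝ => x₀ + t • κ) 0
      (by rw [hl0]; exact hgd.hasFDerivAt) hline)
    have lw := (HasFDerivAt.comp_hasDerivAt (f := fun t : ℝ => x₀ + t • κ) 0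
      (by rw [hl0]; exact hasFDerivAt_norm_sq_sub_comp hc hσ h0) hline)
    have lu := (HasFDerivAt.comp_hasDerivAt (f := fun t : ℝ => x₀ + t • κ) 0
      (by rw [hl0]; exact hκf.inner ℝ (hasFDerivAt_sub_comp hc hσ)) hline)
    have l2 := ((lw.const_sub (A ^ 2)).div ((lu.const_sub 1).const_mul (2 * A)) (by
      simp only [Function.comp, hl0]
      exact mul_ne_zero (by simpa using hA) hu1)).neg
    have l3 := l1.unique l2
    rw [l3]
    simp only [Function.comp, hl0, ← hs, ← hκdef, ← hudef, ← hwdef]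
    have hin : inner ℝ x₀ κ - inner ℝ (c s) κ = u := by
      rw [hudef, ← inner_sub_left, real_inner_comm]
    simp [fderivInnerCLM_apply, hσκ]
    rw [hin]
    field_simp
    ring
  have e4 : (fun x => footField c A (σ x) x) = fun x => A⁻¹ • (x - c (σ x)) +
      (-((A ^ 2 - ‖x - c (σ x)‖ ^ 2) / (2 * A * (1 - inner ℝ (curvatureVector c (σ x))
        (x - c (σ x)))))) • curvatureVector c (σ x) := rfl
  rw [e4, divergence_add (φ := fun x => A⁻¹ • (x - c (σ x)))
      (ψ := fun x => (-((A ^ 2 - ‖x - c (σ x)‖ ^ 2) / (2 * A * (1 - inner ℝ (curvatureVector c (σ x))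
        (x - c (σ x)))))) • curvatureVector c (σ x)) (hyd.const_smul A⁻¹) (hgd.smul hκd),
    divergence_const_smul _ hyd, divergence_smul hgd hκd, e1, e2, ← hs, ← hκdef, e3, ← hudef,
    ← hwdef]
  field_simp
  ring

end Curvature

theorem Function.Periodic.deriv_periodic {E : Type*} [NormedAddCommGroup E] [NormedSpace ℝ E]
    {c : ℝ → E} {L : ℝ} (h : Function.Periodic c L) : Function.Periodic (deriv c) L := fun s => by
  rw [← deriv_comp_add_const, funext h]

/-! ### Nearest parameters on a closed curve -/

section NearestPoint

variable {d : ℕ} {c : ℝ → Euc d} {L : ℝ}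

theorem isCompact_range_of_periodic (hc : Continuous c) (hper : Function.Periodic c L)
    (hL : 0 < L) : IsCompact (range c) := by
  rw [← hper.image_Icc hL 0]
  exact isCompact_Icc.image hc

theorem exists_dist_eq_infDist_range (hc : Continuous c) (hper : Function.Periodic c L)
    (hL : 0 < L) (x : Euc d) : ∃ s, dist x (c s) = infDist x (range c) := by
  obtain ⟨_, ⟨s, rfl⟩, hs⟩ := (isCompact_range_of_periodic hc hper hL).exists_infDist_eq_dist
    (range_nonempty c) x
  exact ⟨s, hs.symm⟩

theorem hasDerivAt_norm_sub_sq (hc : ContDiff ℝ ∞ c) (x : Euc d) (s : ℝ) :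
    HasDerivAt (fun t => ‖x - c t‖ ^ 2) (-2 * inner ℝ (x - c s) (deriv c s)) s := by
  have := ((hasDerivAt_of_contDiff_infty hc s).const_sub x).norm_sq
  simpa using this

theorem inner_sub_deriv_eq_zero_of_nearest (hc : ContDiff ℝ ∞ c) {x : Euc d} {s : ℝ}
    (h : dist x (c s) = infDist x (range c)) : inner ℝ (x - c s) (deriv c s) = 0 := by
  have hmin : IsLocalMin (fun t => ‖x - c t‖ ^ 2) s := by
    refine Eventually.of_forall fun t => ?_
    have : dist x (c s) ≤ dist x (c t) := h ▸ infDist_le_dist_of_mem (mem_range_self t)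
    rw [dist_eq_norm, dist_eq_norm] at this
    dsimp only
    gcongr
  have := hmin.hasDerivAt_eq_zero (hasDerivAt_norm_sub_sq hc x s)
  linarith

/-- Uniqueness of the nearest parameter makes it stable under perturbations of the point. -/
theorem eventually_exists_nearest_mem_Ioo (hc : Continuous c) (hper : Function.Periodic c L)
    (hL : 0 < L) {x₀ : Euc d} {s₀ δ : ℝ} (hδ : 0 < δ)
    (huniq : ∀ t, dist x₀ (c t) = infDist x₀ (range c) → ∃ n : ℤ, t = s₀ + n * L) :
    ∀ᶠ x in 𝓝 x₀, ∀ t, dist x (c t) = infDist x (range c) →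
      ∃ s ∈ Ioo (s₀ - δ) (s₀ + δ), c s = c t := by
  -- `K` is the part of a period away from `s₀`. By compactness the distance from `x₀` to `c` on `K`
  -- exceeds the minimum by a definite amount. A displacement of `x₀` by less than half of that
  -- excess cannot make a parameter in `K` nearest.
  set K := Icc (s₀ + δ / 2) (s₀ + L - δ / 2)
  have hlt : ∀ t ∈ K, infDist x₀ (range c) < dist x₀ (c t) := by
    intro t ht
    refine lt_of_le_of_ne (infDist_le_dist_of_mem (mem_range_self t)) fun he => ?_
    obtain ⟨n, hn⟩ := huniq t he.symm
    have h1 : 0 < (n : ℝ) * L := by linarith [ht.1]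
    have h2 : (n : ℝ) * L < 1 * L := by linarith [ht.2]
    have h3 : (0 : ℝ) < n := pos_of_mul_pos_left h1 hL.le
    have h4 : (n : ℝ) < 1 := lt_of_mul_lt_mul_right h2 hL.le
    norm_cast at h3 h4
    lia
  obtain ⟨m, hm, hmK⟩ := isCompact_Icc.exists_forall_le' (s := K)
    (f := fun t => dist x₀ (c t)) (by fun_prop) hlt
  filter_upwards [ball_mem_nhds x₀ (show 0 < (m - infDist x₀ (range c)) / 2 by linarith)]
    with x hx t ht
  obtain ⟨s, hs, hst⟩ := hper.exists_mem_Ico hL t (s₀ - δ / 2)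
  refine ⟨s, ⟨by linarith [hs.1], ?_⟩, hst.symm⟩
  by_contra hcon
  have hsK : s ∈ K := ⟨by linarith, by linarith [hs.2]⟩
  have h1 := hmK s hsK
  have h2 : dist x₀ (c s) ≤ dist x₀ x + dist x (c s) := dist_triangle _ _ _
  have h3 : infDist x (range c) ≤ infDist x₀ (range c) + dist x x₀ := infDist_le_infDist_add_dist
  rw [← hst] at h1 h2
  rw [ht] at h2
  rw [mem_ball] at hx
  rw [dist_comm x₀ x] at h2
  linarith

/-- The selection `φ` of nearest parameters is arbitrary and may jump by multiples of `L`. Stability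
of the nearest parameter together with local uniqueness of feet shows that modulo `L` it agrees with
a differentiable `σ`. -/
theorem exists_local_nearest (hc : ContDiff ℝ ∞ c) (hper : Function.Periodic c L) (hL : 0 < L)
    {x₀ : Euc d} {φ : Euc d → ℝ} (hφ : ∀ x, dist x (c (φ x)) = infDist x (range c))
    (hD : footJacobian c x₀ (φ x₀) ≠ 0)
    (huniq : ∀ᶠ x in 𝓝 x₀, ∀ s t, dist x (c s) = infDist x (range c) →
      dist x (c t) = infDist x (range c) → ∃ n : ℤ, t = s + n * L) :
    ∃ σ : Euc d → ℝ, ContDiffAt ℝ 1 σ x₀ ∧ σ x₀ = φ x₀ ∧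
      (∀ᶠ x in 𝓝 x₀, ∃ n : ℤ, φ x = σ x + n * L) ∧
      ∀ v, fderiv ℝ σ x₀ v = inner ℝ (deriv c (φ x₀)) v / footJacobian c x₀ (φ x₀) := by
  obtain ⟨σ, h1, h2, -, h4, h5⟩ := exists_local_foot hc
    (inner_sub_deriv_eq_zero_of_nearest hc (hφ x₀)) hD
  refine ⟨σ, h1, h2, ?_, h5⟩
  rw [nhds_prod_eq, eventually_prod_iff] at h4
  obtain ⟨P, hP, Q, hQ, hPQ⟩ := h4
  obtain ⟨δ, hδ, hQδ⟩ := Metric.eventually_nhds_iff_ball.1 hQ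
  filter_upwards [hP, huniq, eventually_exists_nearest_mem_Ioo hc.continuous hper hL hδ
    (fun t => huniq.self_of_nhds (φ x₀) t (hφ x₀))] with x hxP hxu hx
  obtain ⟨s, hs, hst⟩ := hx (φ x) (hφ x)
  have hsn : dist x (c s) = infDist x (range c) := hst ▸ hφ x
  have : σ x = s := hPQ hxP (hQδ s (by rwa [Real.ball_eq_Ioo]))
    (inner_sub_deriv_eq_zero_of_nearest hc hsn)
  rw [this]
  exact hxu s (φ x) hsn (hφ x)

end NearestPoint

/-! ### The norm of the calibrating field -/

section Bounds

variable {A r u k : ℝ}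

/-- Here `r`, `k`, `u` stand for `‖y‖`, `‖κ‖`, `⟪κ, y⟫`. The claim reduces to `k²(A² - r²) + (1 -
u)² ≤ 4(1 - u)`, and each summand is at most `2(1 - u)`. The first is bounded by `(1 - kr)(1 + kr) ≤
2(1 - kr)`, and the second uses `1 - u ≤ 2`. -/
theorem calibration_norm_bound (hA : 0 < A) (hr : 0 ≤ r) (hrA : r ≤ A) (hk : 0 ≤ k)
    (hkA : k * A ≤ 1) (hu : |u| ≤ k * r) (hu1 : 0 < 1 - u) :
    (A ^ 2 - r ^ 2) / (4 * A ^ 2) ≤ 1 - (r ^ 2 / A ^ 2 + 2 * (A⁻¹ *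
      (-((A ^ 2 - r ^ 2) / (2 * A * (1 - u))) * u)) +
      (-((A ^ 2 - r ^ 2) / (2 * A * (1 - u)))) ^ 2 * k ^ 2) := by
  obtain ⟨hu2, hu3⟩ := abs_le.1 hu
  have hkr : k * r ≤ k * A := by gcongr
  have hkr0 : 0 ≤ k * r := by positivity
  have hP : 0 ≤ A ^ 2 - r ^ 2 := by nlinarith
  have hkP : k ^ 2 * (A ^ 2 - r ^ 2) ≤ 2 * (1 - u) := by
    have h1 : (k * A) ^ 2 ≤ 1 := by nlinarith
    have h2 : (1 - k * r) * (1 + k * r) ≤ (1 - k * r) * 2 := by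
      gcongr <;> linarith
    nlinarith
  have hJ : (1 - u) ^ 2 ≤ 2 * (1 - u) := by nlinarith
  have key : 1 - (r ^ 2 / A ^ 2 + 2 * (A⁻¹ *
      (-((A ^ 2 - r ^ 2) / (2 * A * (1 - u))) * u)) +
      (-((A ^ 2 - r ^ 2) / (2 * A * (1 - u)))) ^ 2 * k ^ 2) - (A ^ 2 - r ^ 2) / (4 * A ^ 2) =
      (A ^ 2 - r ^ 2) * (4 * (1 - u) - k ^ 2 * (A ^ 2 - r ^ 2) - (1 - u) ^ 2) /
        (4 * A ^ 2 * (1 - u) ^ 2) := by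
    field_simp
    ring
  have : 0 ≤ (A ^ 2 - r ^ 2) * (4 * (1 - u) - k ^ 2 * (A ^ 2 - r ^ 2) - (1 - u) ^ 2) /
        (4 * A ^ 2 * (1 - u) ^ 2) :=
    div_nonneg (mul_nonneg hP (by linarith)) (by positivity)
  linarith

end Bounds

/-! ### Construction of the calibration -/

section Calibration

variable {d : ℕ} {c : ℝ → Euc d} {L b : ℝ}

/-- Otherwise the centre of curvature, at `y = κ / ‖κ‖²`, is closer than `b`, and there the focal
inequality is an equality. -/
theorem norm_curvatureVector_mul_le_one (hreg : ∀ s, deriv c s ≠ 0)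
    (hJ : ∀ s y, inner ℝ y (deriv c s) = 0 → ‖y‖ < b →
      inner ℝ y (deriv (deriv c) s) < ‖deriv c s‖ ^ 2) (s : ℝ) :
    ‖curvatureVector c s‖ * b ≤ 1 := by
  set κ := curvatureVector c s with hκ
  by_contra! h
  have hκ0 : 0 < ‖κ‖ := by
    refine (norm_nonneg κ).lt_of_ne fun h0 => ?_
    rw [← h0] at h
    linarith
  have h1 : inner ℝ ((‖κ‖ ^ 2)⁻¹ • κ) (deriv c s) = 0 := by
    rw [inner_smul_left, inner_curvatureVector_deriv hreg, mul_zero]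
  have h2 := hJ s _ h1 (by
    rw [norm_smul, norm_inv, norm_pow, norm_norm, pow_two, mul_inv, mul_assoc,
      inv_mul_cancel₀ hκ0.ne', mul_one, inv_lt_iff_one_lt_mul₀ hκ0]
    rwa [mul_comm])
  rw [← inner_curvatureVector_of_normal hreg h1, inner_smul_right, real_inner_self_eq_norm_sq,
    inv_mul_cancel₀ (by positivity), mul_one] at h2
  exact lt_irrefl _ h2

/-- A closed regular curve with unique nearest points and no focal points within distance `b`
admits a tube calibration. -/
theorem exists_isTubeCalibration (hc : ContDiff ℝ ∞ c) (hreg : ∀ s, deriv c s ≠ 0)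
    (hper : Function.Periodic c L) (hL : 0 < L)
    (hJ : ∀ s y, inner ℝ y (deriv c s) = 0 → ‖y‖ < b →
      inner ℝ y (deriv (deriv c) s) < ‖deriv c s‖ ^ 2)
    (huniq : ∀ x, infDist x (range c) < b → ∀ s t, dist x (c s) = infDist x (range c) →
      dist x (c t) = infDist x (range c) → ∃ n : ℤ, t = s + n * L) :
    ∃ y f, IsTubeCalibration (range c) b y f := by
  -- An arbitrary selection suffices: the fields involve `φ` only through `c` and `κ`, which are
  -- periodic, so near each point `φ` may be replaced by a differentiable `σ`.
  choose φ hφ using exists_dist_eq_infDist_range hc.continuous hper hL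
  have horth : ∀ x, inner ℝ (x - c (φ x)) (deriv c (φ x)) = 0 := fun x =>
    inner_sub_deriv_eq_zero_of_nearest hc (hφ x)
  have hnorm : ∀ x, ‖x - c (φ x)‖ = infDist x (range c) := fun x => by
    rw [← dist_eq_norm, hφ x]
  have hκb := norm_curvatureVector_mul_le_one hreg hJ
  have hu : ∀ x, |inner ℝ (curvatureVector c (φ x)) (x - c (φ x))| ≤
      ‖curvatureVector c (φ x)‖ * infDist x (range c) := fun x => by
    rw [← hnorm x]
    exact abs_real_inner_le_norm _ _
  have hJpos : ∀ x, infDist x (range c) < b → 0 < footJacobian c x (φ x) := fun x hx => by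
    have := hJ (φ x) _ (horth x) (by rwa [hnorm x])
    rw [footJacobian]
    linarith
  have hu1 : ∀ x, infDist x (range c) < b →
      0 < 1 - inner ℝ (curvatureVector c (φ x)) (x - c (φ x)) := fun x hx => by
    have := hJpos x hx
    rw [footJacobian_eq hreg (horth x)] at this
    exact pos_of_mul_pos_right this (by positivity)
  have hdper : Function.Periodic (deriv c) L := hper.deriv_periodic
  have hκper : Function.Periodic (curvatureVector c) L := fun s => by
    simp only [curvatureVector, hdper.deriv_periodic s, hdper s]
  have hloc : ∀ x₀, infDist x₀ (range c) < b → ∃ σ : Euc d → ℝ, ContDiffAt ℝ 1 σ x₀ ∧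
      σ x₀ = φ x₀ ∧ (∀ᶠ x in 𝓝 x₀, c (φ x) = c (σ x) ∧
        curvatureVector c (φ x) = curvatureVector c (σ x)) ∧
      ∀ v, fderiv ℝ σ x₀ v = inner ℝ (deriv c (φ x₀)) v / footJacobian c x₀ (φ x₀) := by
    intro x₀ hx₀
    have hev : ∀ᶠ x in 𝓝 x₀, infDist x (range c) < b :=
      (continuous_infDist_pt _).continuousAt.eventually_lt_const hx₀
    obtain ⟨σ, h1, h2, h3, h4⟩ := exists_local_nearest hc hper hL hφ (hJpos x₀ hx₀).ne'
      (hev.mono fun x hx => huniq x hx)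
    refine ⟨σ, h1, h2, h3.mono fun x ⟨n, hn⟩ => ?_, h4⟩
    rw [hn]
    exact ⟨hper.int_mul n _, hκper.int_mul n _⟩
  have hfield : ∀ x₀, infDist x₀ (range c) < b → ∀ A, ∃ σ : Euc d → ℝ, ContDiffAt ℝ 1 σ x₀ ∧
      σ x₀ = φ x₀ ∧ ((fun x => footField c A (φ x) x) =ᶠ[𝓝 x₀] fun x => footField c A (σ x) x) ∧
      ((fun x => infDist x (range c) ^ 2) =ᶠ[𝓝 x₀] fun x => ‖x - c (σ x)‖ ^ 2) ∧
      ∀ v, fderiv ℝ σ x₀ v = inner ℝ (deriv c (φ x₀)) v / footJacobian c x₀ (φ x₀) := by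
    intro x₀ hx₀ A
    obtain ⟨σ, h1, h2, h3, h4⟩ := hloc x₀ hx₀
    refine ⟨σ, h1, h2, h3.mono fun x hx => ?_, h3.mono fun x hx => ?_, h4⟩
    · simp only [footField, hx.1, hx.2]
    · dsimp only
      rw [← hx.1, hnorm x]
  refine ⟨fun x => x - c (φ x), fun A x => footField c A (φ x) x,
    isCompact_range_of_periodic hc.continuous hper hL, range_nonempty c, fun x _ => hnorm x,
    ?_, ?_, ?_, ?_, ?_, ?_⟩
  · intro x hx
    obtain ⟨σ, h1, h2, -, h4, -⟩ := hfield x hx 1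
    exact ((contDiffAt_sub_comp hc h1).norm_sq ℝ).congr_of_eventuallyEq h4
  · intro x hx v
    obtain ⟨σ, h1, h2, -, h4, -⟩ := hfield x hx 1
    rw [h4.fderiv_eq, (hasFDerivAt_norm_sq_sub_comp hc h1 (by rw [h2]; exact horth x)).fderiv, h2]
    simp [inner_sub_left]
  · intro A hA hAb x hx
    obtain ⟨σ, h1, h2, h3, -, -⟩ := hfield x hx A
    refine (contDiffAt_footField hc hreg hA.ne' h1 ?_).congr_of_eventuallyEq h3
    rw [h2]
    linarith [hu1 x hx]
  · intro A hA hAb x hx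
    obtain ⟨σ, h1, h2, h3, -, h5⟩ := hfield x hx A
    rw [divergence_congr h3]
    refine divergence_footField hc hreg hA.ne' h1 ?_ ?_ ?_
    · rw [h2]; exact horth x
    · rw [h2]; linarith [hu1 x hx]
    · rw [h2]; exact h5
  · intro A hA hAb x hx
    have hx' := hx.trans_lt hAb
    convert calibration_norm_bound hA infDist_nonneg hx (norm_nonneg (curvatureVector c (φ x)))
      ?_ (hu x) (hu1 x hx') using 2
    · rw [footField, norm_add_sq_real, norm_smul, norm_smul, inner_smul_left, inner_smul_right,
        mul_pow, mul_pow, hnorm x, real_inner_comm (x - c (φ x))]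
      simp only [conj_trivial, norm_inv, Real.norm_eq_abs, sq_abs, inv_pow]
      ring
    · exact (mul_le_mul_of_nonneg_left hAb.le (norm_nonneg _)).trans (hκb _)
  · intro A hA hAb
    have hb : 0 < b := hA.trans hAb
    have hAb1 : 0 < 1 - A / b := by rw [sub_pos, div_lt_one hb]; exact hAb
    -- The inner product equals `r²/A - u(A² - r²)/(2A(1 - u))`. Since `‖κ‖ b ≤ 1` and `r ≤ A`, we
    -- have `u ≤ A / b < 1`, which bounds the coefficient by this constant.
    refine ⟨(2 * A * (1 - A / b))⁻¹, fun x hx => ?_⟩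
    have hx' := hx.trans_lt hAb
    have hr := infDist_nonneg (x := x) (s := range c)
    set u := inner ℝ (curvatureVector c (φ x)) (x - c (φ x)) with hudef
    have huA : u ≤ A / b := by
      refine (le_abs_self u).trans ((hu x).trans ?_)
      rw [le_div_iff₀ hb]
      calc ‖curvatureVector c (φ x)‖ * infDist x (range c) * b
          = (‖curvatureVector c (φ x)‖ * b) * infDist x (range c) := by ring
        _ ≤ 1 * infDist x (range c) := by gcongr; exact hκb _
        _ ≤ A := by linarith
    have hu1' : u ≤ 1 := by linarith
    have e : inner ℝ (footField c A (φ x) x) (x - c (φ x)) = infDist x (range c) ^ 2 / A -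
        u * (2 * A * (1 - u))⁻¹ * (A ^ 2 - infDist x (range c) ^ 2) := by
      rw [footField, inner_add_left, inner_smul_left, inner_smul_left, real_inner_self_eq_norm_sq,
        hnorm x, ← hudef]
      simp only [conj_trivial]
      ring
    rw [e]
    have hP : 0 ≤ A ^ 2 - infDist x (range c) ^ 2 := by nlinarith
    have h1 : u * (2 * A * (1 - u))⁻¹ ≤ (2 * A * (1 - A / b))⁻¹ := by
      have h2 : (2 * A * (1 - u))⁻¹ ≤ (2 * A * (1 - A / b))⁻¹ := by
        gcongr
      have h3 : 0 ≤ (2 * A * (1 - u))⁻¹ := by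
        have := hu1 x hx'
        positivity
      nlinarith
    nlinarith [mul_le_mul_of_nonneg_right h1 hP]

end Calibration

/-! ### Unit normal fields with prescribed values -/

/-- A smooth unit normal field along the closed curve `c` of period `L`. -/
structure IsPeriodicNormalField {d : ℕ} (c : ℝ → Euc d) (L : ℝ) (N : ℝ → Euc d) : Prop where
  contDiff : ContDiff ℝ ∞ N
  periodic : Function.Periodic N L
  norm_eq_one : ∀ s, ‖N s‖ = 1
  inner_eq_zero : ∀ s, inner ℝ (N s) (deriv c s) = 0

section Fields

variable {d : ℕ} {c : ℝ → Euc d} {L : ℝ}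

theorem IsPeriodicNormalField.neg {N : ℝ → Euc d} (h : IsPeriodicNormalField c L N) :
    IsPeriodicNormalField c L fun s => -N s :=
  ⟨h.contDiff.neg, fun s => by rw [h.periodic s], fun s => by rw [norm_neg, h.norm_eq_one],
    fun s => by rw [inner_neg_left, h.inner_eq_zero, neg_zero]⟩

/-- The normal part of a field along a curve, normalised. -/
noncomputable def normalisedNormalPart (c V : ℝ → Euc d) (s : ℝ) : Euc d :=
  ‖V s - (inner ℝ (V s) (deriv c s) * (‖deriv c s‖ ^ 2)⁻¹) • deriv c s‖⁻¹ •
    (V s - (inner ℝ (V s) (deriv c s) * (‖deriv c s‖ ^ 2)⁻¹) • deriv c s)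

variable {V : ℝ → Euc d}

theorem isPeriodicNormalField_normalisedNormalPart (hc : ContDiff ℝ ∞ c)
    (hreg : ∀ s, deriv c s ≠ 0) (hper : Function.Periodic c L) (hV : ContDiff ℝ ∞ V)
    (hVper : Function.Periodic V L) (hVT : ∀ s (z : ℝ), V s ≠ z • deriv c s) :
    IsPeriodicNormalField c L (normalisedNormalPart c V) := by
  have hc' := contDiff_deriv_of_contDiff_infty hc
  have hW : ∀ s, V s - (inner ℝ (V s) (deriv c s) * (‖deriv c s‖ ^ 2)⁻¹) • deriv c s ≠ 0 :=
    fun s => sub_ne_zero.2 (hVT s _)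
  have hT : ∀ s, ‖deriv c s‖ ≠ 0 := fun s => norm_ne_zero_iff.2 (hreg s)
  have hν : ContDiff ℝ ∞ fun s => (‖deriv c s‖ ^ 2)⁻¹ :=
    (hc'.norm_sq ℝ).inv fun s => pow_ne_zero 2 (hT s)
  have hWd : ContDiff ℝ ∞
      fun s => V s - (inner ℝ (V s) (deriv c s) * (‖deriv c s‖ ^ 2)⁻¹) • deriv c s :=
    hV.sub (((hV.inner ℝ hc').mul hν).smul hc')
  refine ⟨?_, fun s => ?_, fun s => ?_, fun s => ?_⟩
  · exact ((hWd.norm ℝ hW).inv fun s => norm_ne_zero_iff.2 (hW s)).smul hWd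
  · simp only [normalisedNormalPart, hVper s, hper.deriv_periodic s]
  · rw [normalisedNormalPart, norm_smul, norm_inv, norm_norm,
      inv_mul_cancel₀ (norm_ne_zero_iff.2 (hW s))]
  · rw [normalisedNormalPart, inner_smul_left, inner_sub_left, inner_smul_left,
      real_inner_self_eq_norm_sq]
    have := hT s
    simp only [conj_trivial]
    field_simp
    ring

theorem normalisedNormalPart_eq {s : ℝ} (h0 : inner ℝ (V s) (deriv c s) = 0) (h1 : ‖V s‖ = 1) :
    normalisedNormalPart c V s = V s := by
  simp [normalisedNormalPart, h0, h1]

/-- Subtracting a multiple of `deriv c` and rescaling change the derivative only within the span of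
`V s`, `deriv c s` and `deriv (deriv c) s`. The last does not appear, because its coefficient
vanishes at a point where `V` is already normal. -/
theorem exists_deriv_normalisedNormalPart (hc : ContDiff ℝ ∞ c)
    (hreg : ∀ s, deriv c s ≠ 0) (hV : ContDiff ℝ ∞ V) {s α : ℝ}
    (h0 : inner ℝ (V s) (deriv c s) = 0) (h1 : ‖V s‖ = 1) (hα : deriv V s = α • V s) :
    ∃ α β : ℝ, deriv (normalisedNormalPart c V) s =
      α • normalisedNormalPart c V s + β • deriv c s := by
  have hc' := contDiff_deriv_of_contDiff_infty hc
  have hT : ∀ s, ‖deriv c s‖ ≠ 0 := fun s => norm_ne_zero_iff.2 (hreg s)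
  have hμ : ContDiff ℝ ∞ fun s => inner ℝ (V s) (deriv c s) * (‖deriv c s‖ ^ 2)⁻¹ :=
    (hV.inner ℝ hc').mul ((hc'.norm_sq ℝ).inv fun s => pow_ne_zero 2 (hT s))
  have hWs : V s - (inner ℝ (V s) (deriv c s) * (‖deriv c s‖ ^ 2)⁻¹) • deriv c s = V s := by
    simp [h0]
  have hW := (hasDerivAt_of_contDiff_infty hV s).sub
    ((hasDerivAt_of_contDiff_infty hμ s).smul (hasDerivAt_of_contDiff_infty hc' s))
  have hν : DifferentiableAt ℝ
      (fun s => ‖V s - (inner ℝ (V s) (deriv c s) * (‖deriv c s‖ ^ 2)⁻¹) • deriv c s‖⁻¹) s := by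
    refine (DifferentiableAt.norm ℝ hW.differentiableAt ?_).inv ?_
    · simp only [Pi.sub_apply, Pi.smul_apply']
      rw [hWs, ← norm_ne_zero_iff, h1]
      exact one_ne_zero
    · simp only [Pi.sub_apply, Pi.smul_apply']
      rw [hWs, h1]
      exact one_ne_zero
  have hN := hν.hasDerivAt.smul hW
  have h2 : deriv (normalisedNormalPart c V) s = _ := hN.deriv
  rw [normalisedNormalPart_eq h0 h1, h2]
  simp only [Pi.sub_apply, Pi.smul_apply', h1, hα, h0, zero_mul, zero_smul, inv_one, one_smul,
    zero_add, sub_zero]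
  exact ⟨α + deriv (fun s => ‖V s - (inner ℝ (V s) (deriv c s) *
    (‖deriv c s‖ ^ 2)⁻¹) • deriv c s‖⁻¹) s,
    -deriv (fun s => inner ℝ (V s) (deriv c s) * (‖deriv c s‖ ^ 2)⁻¹) s, by module⟩

/-- An `L`-periodic smooth function vanishing exactly on `a + ℤ L`, to second order. -/
noncomputable def sinSq (L a s : ℝ) : ℝ := Real.sin (Real.pi * (s - a) / L) ^ 2

theorem contDiff_sinSq (a : ℝ) : ContDiff ℝ ∞ (sinSq L a) := by
  have : ContDiff ℝ ∞ fun s : ℝ => Real.pi * (s - a) / L :=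
    (contDiff_const.mul (contDiff_id.sub contDiff_const)).div_const L
  exact (Real.contDiff_sin.comp this).pow 2

theorem periodic_sinSq (hL : 0 < L) (a : ℝ) : Function.Periodic (sinSq L a) L := fun s => by
  rw [sinSq, sinSq, show Real.pi * (s + L - a) / L = Real.pi * (s - a) / L + Real.pi by
    field_simp; ring, Real.sin_add_pi, neg_sq]

theorem sinSq_eq_zero_iff (hL : 0 < L) {a s : ℝ} :
    sinSq L a s = 0 ↔ ∃ n : ℤ, s = a + n * L := by
  rw [sinSq, sq_eq_zero_iff, Real.sin_eq_zero_iff]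
  refine exists_congr fun n => ?_
  have := Real.pi_ne_zero
  rw [eq_div_iff hL.ne']
  constructor
  · intro h
    have : Real.pi * (s - a - n * L) = 0 := by linarith
    rcases mul_eq_zero.1 this with h | h
    · exact absurd h Real.pi_ne_zero
    · linarith
  · rintro rfl
    ring

theorem sinSq_self (a : ℝ) : sinSq L a a = 0 := by simp [sinSq]

theorem deriv_sinSq_self (a : ℝ) : deriv (sinSq L a) a = 0 := by
  have hmin : IsLocalMin (sinSq L a) a :=
    Eventually.of_forall fun s => by rw [sinSq_self]; exact sq_nonneg _
  exact hmin.deriv_eq_zero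

theorem sinSq_comm (a s : ℝ) : sinSq L a s = sinSq L s a := by
  rw [sinSq, sinSq, show Real.pi * (s - a) / L = -(Real.pi * (a - s) / L) by ring, Real.sin_neg,
    neg_sq]

/-- In dimension at least three a generic vector avoids a given two-parameter family. -/
theorem exists_forall_smul_ne (hd : 3 ≤ d) {θ : ℝ → ℝ} {A T : ℝ → Euc d}
    (hθ : ContDiff ℝ ∞ θ) (hA : ContDiff ℝ ∞ A) (hT : ContDiff ℝ ∞ T) :
    ∃ e : Euc d, ∀ s (z : ℝ), θ s ≠ 0 → A s + θ s • e ≠ z • T s := by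
  set f : ℝ × ℝ → Euc d := fun p => (θ p.1)⁻¹ • (p.2 • T p.1 - A p.1) with hf
  set U : Set (ℝ × ℝ) := {p | θ p.1 ≠ 0} with hU
  -- A vector `e` is bad exactly when it lies in the image of `f` on `U`. This image of a planar set
  -- under a locally Lipschitz map has Hausdorff dimension at most `2 < d`, so its complement is
  -- dense.
  have hdim : dimH (f '' U) ≤ dimH U := by
    refine dimH_image_le_of_locally_lipschitzOn fun p hp => ?_
    have hfp : ContDiffAt ℝ 1 f p := by
      have h1 : ContDiff ℝ 1 θ := hθ.of_le (by simp)
      have h2 : ContDiff ℝ 1 A := hA.of_le (by simp)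
      have h3 : ContDiff ℝ 1 T := hT.of_le (by simp)
      refine ContDiffAt.smul (ContDiffAt.inv (h1.comp contDiff_fst).contDiffAt hp) ?_
      exact ((contDiff_snd.smul (h3.comp contDiff_fst)).sub (h2.comp contDiff_fst)).contDiffAt
    obtain ⟨K, t, ht, hK⟩ := hfp.exists_lipschitzOnWith
    exact ⟨K, t, mem_nhdsWithin_of_mem_nhds ht, hK⟩
  have hlt : dimH (f '' U) < Module.finrank ℝ (Euc d) := by
    refine (hdim.trans (dimH_mono (subset_univ U))).trans_lt ?_
    rw [Real.dimH_univ_eq_finrank, finrank_euclideanSpace_fin]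
    simp only [Module.finrank_prod, Module.finrank_self]
    exact_mod_cast (by lia : 1 + 1 < d)
  obtain ⟨e, he⟩ := (dense_compl_of_dimH_lt_finrank hlt).nonempty
  refine ⟨e, fun s z hs h => he ⟨(s, z), hs, ?_⟩⟩
  simp only [hf]
  rw [← h, add_sub_cancel_left, smul_smul, inv_mul_cancel₀ hs, one_smul]

/-- Interpolate between `n₁` and `n₂` with weights `sinSq`, add a generic constant vector `e` with a
weight vanishing at both parameters to avoid tangency elsewhere, and take the normalised normal
part. The double zero of `sinSq` at `s₁` removes `n₂` and `e` from the derivative there, which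
yields the last clause, needed by `no_focal_point`. -/
theorem exists_normalField_through_two (hd : 3 ≤ d) (hc : ContDiff ℝ ∞ c)
    (hreg : ∀ s, deriv c s ≠ 0) (hper : Function.Periodic c L) (hL : 0 < L) {s₁ s₂ : ℝ}
    (hs : ¬∃ n : ℤ, s₂ = s₁ + n * L) {n₁ n₂ : Euc d} (hn₁ : ‖n₁‖ = 1) (hn₂ : ‖n₂‖ = 1)
    (h₁ : inner ℝ n₁ (deriv c s₁) = 0) (h₂ : inner ℝ n₂ (deriv c s₂) = 0) :
    ∃ N, IsPeriodicNormalField c L N ∧ N s₁ = n₁ ∧ N s₂ = n₂ ∧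
      ∃ α β : ℝ, deriv N s₁ = α • N s₁ + β • deriv c s₁ := by
  have hS : sinSq L s₁ s₂ ≠ 0 := fun h => hs ((sinSq_eq_zero_iff hL).1 h)
  have hS' : sinSq L s₂ s₁ ≠ 0 := by rwa [sinSq_comm]
  set A : ℝ → Euc d := fun s => (sinSq L s₂ s * (sinSq L s₂ s₁)⁻¹) • n₁ +
    (sinSq L s₁ s * (sinSq L s₁ s₂)⁻¹) • n₂ with hAdef
  have hA : ContDiff ℝ ∞ A := (((contDiff_sinSq s₂).mul contDiff_const).smul contDiff_const).add
    (((contDiff_sinSq s₁).mul contDiff_const).smul contDiff_const)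
  have hθ : ContDiff ℝ ∞ fun s => sinSq L s₁ s * sinSq L s₂ s :=
    (contDiff_sinSq s₁).mul (contDiff_sinSq s₂)
  obtain ⟨e, he⟩ := exists_forall_smul_ne hd hθ hA (contDiff_deriv_of_contDiff_infty hc)
  set V : ℝ → Euc d := fun s => A s + (sinSq L s₁ s * sinSq L s₂ s) • e with hVdef
  have hV : ContDiff ℝ ∞ V := hA.add (hθ.smul contDiff_const)
  have hVper : Function.Periodic V L := fun s => by
    simp only [hVdef, hAdef, periodic_sinSq hL _ s]
  have hV1 : V s₁ = n₁ := by simp [hVdef, hAdef, sinSq_self, hS']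
  have hV2 : V s₂ = n₂ := by simp [hVdef, hAdef, sinSq_self, hS]
  have hne : ∀ {s : ℝ} {n : Euc d}, ‖n‖ = 1 → inner ℝ n (deriv c s) = 0 → ∀ z : ℝ,
      n ≠ z • deriv c s := by
    intro s n hn h z hz
    have : inner ℝ n n = (0 : ℝ) := by
      nth_rewrite 2 [hz]
      rw [inner_smul_right, h, mul_zero]
    rw [real_inner_self_eq_norm_sq, hn] at this
    norm_num at this
  have hVT : ∀ s (z : ℝ), V s ≠ z • deriv c s := by
    intro s z
    by_cases h1 : sinSq L s₁ s = 0
    · obtain ⟨n, rfl⟩ := (sinSq_eq_zero_iff hL).1 h1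
      rw [(hVper.int_mul n) s₁, (hper.deriv_periodic.int_mul n) s₁, hV1]
      exact hne hn₁ h₁ z
    by_cases h2 : sinSq L s₂ s = 0
    · obtain ⟨n, rfl⟩ := (sinSq_eq_zero_iff hL).1 h2
      rw [(hVper.int_mul n) s₂, (hper.deriv_periodic.int_mul n) s₂, hV2]
      exact hne hn₂ h₂ z
    exact he s z (mul_ne_zero h1 h2)
  have hVd : deriv V s₁ = (deriv (sinSq L s₂) s₁ * (sinSq L s₂ s₁)⁻¹) • V s₁ := by
    have d1 := hasDerivAt_of_contDiff_infty (contDiff_sinSq (L := L) s₁) s₁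
    have d2 := hasDerivAt_of_contDiff_infty (contDiff_sinSq (L := L) s₂) s₁
    rw [deriv_sinSq_self] at d1
    have d3 := (((d2.mul_const (sinSq L s₂ s₁)⁻¹).smul_const n₁).add
      ((d1.mul_const (sinSq L s₁ s₂)⁻¹).smul_const n₂)).add ((d1.mul d2).smul_const e)
    have d4 : deriv V s₁ = _ := d3.deriv
    rw [d4, hV1]
    simp [sinSq_self]
  refine ⟨normalisedNormalPart c V,
    isPeriodicNormalField_normalisedNormalPart hc hreg hper hV hVper hVT, ?_, ?_,
    exists_deriv_normalisedNormalPart hc hreg hV (by rw [hV1, h₁]) (by rw [hV1, hn₁]) hVd⟩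
  · rw [normalisedNormalPart_eq (by rw [hV1, h₁]) (by rw [hV1, hn₁]), hV1]
  · rw [normalisedNormalPart_eq (by rw [hV2, h₂]) (by rw [hV2, hn₂]), hV2]

end Fields

/-! ### The unit normal of a plane curve -/

section Planar

/-- Rotation by a right angle in the plane. -/
noncomputable def rotatePlane : Euc 2 →L[ℝ] Euc 2 :=
  LinearMap.toContinuousLinearMap
    { toFun := fun v => !₂[-v 1, v 0]
      map_add' := fun v w => by ext i; fin_cases i <;> simp [add_comm]
      map_smul' := fun r v => by ext i; fin_cases i <;> simp }

theorem rotatePlane_apply (v : Euc 2) : rotatePlane v = !₂[-v 1, v 0] := rfl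

theorem inner_rotatePlane_self (v : Euc 2) : inner ℝ (rotatePlane v) v = 0 := by
  simp [rotatePlane_apply, PiLp.inner_apply, Fin.sum_univ_two]
  ring

theorem norm_rotatePlane (v : Euc 2) : ‖rotatePlane v‖ = ‖v‖ := by
  simp [rotatePlane_apply, EuclideanSpace.norm_eq, Fin.sum_univ_two, add_comm]

theorem norm_sq_smul_eq_rotatePlane (T v : Euc 2) :
    ‖T‖ ^ 2 • v = inner ℝ v (rotatePlane T) • rotatePlane T + inner ℝ v T • T := by
  ext i
  fin_cases i <;> simp [rotatePlane_apply, PiLp.inner_apply, Fin.sum_univ_two,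
    EuclideanSpace.norm_sq_eq] <;> ring

/-- The left unit normal of a plane curve. -/
noncomputable def planeNormal (c : ℝ → Euc 2) (s : ℝ) : Euc 2 :=
  ‖deriv c s‖⁻¹ • rotatePlane (deriv c s)

variable {c : ℝ → Euc 2} {L : ℝ}

theorem isPeriodicNormalField_planeNormal (hc : ContDiff ℝ ∞ c) (hreg : ∀ s, deriv c s ≠ 0)
    (hper : Function.Periodic c L) : IsPeriodicNormalField c L (planeNormal c) := by
  have hc' := contDiff_deriv_of_contDiff_infty hc
  refine ⟨?_, fun s => ?_, fun s => ?_, fun s => ?_⟩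
  · exact ((hc'.norm ℝ hreg).inv fun s => norm_ne_zero_iff.2 (hreg s)).smul
      (rotatePlane.contDiff.comp hc')
  · rw [planeNormal, planeNormal, hper.deriv_periodic s]
  · rw [planeNormal, norm_smul, norm_inv, norm_norm, norm_rotatePlane,
      inv_mul_cancel₀ (norm_ne_zero_iff.2 (hreg s))]
  · rw [planeNormal, inner_smul_left, inner_rotatePlane_self, mul_zero]

theorem exists_eq_planeNormal_add (hreg : ∀ s, deriv c s ≠ 0) (s : ℝ) (v : Euc 2) :
    v = inner ℝ v (planeNormal c s) • planeNormal c s +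
      (inner ℝ v (deriv c s) * (‖deriv c s‖ ^ 2)⁻¹) • deriv c s := by
  have h : ‖deriv c s‖ ≠ 0 := norm_ne_zero_iff.2 (hreg s)
  have h1 := congrArg ((‖deriv c s‖ ^ 2)⁻¹ • ·) (norm_sq_smul_eq_rotatePlane (deriv c s) v)
  simp only [smul_smul, inv_mul_cancel₀ (pow_ne_zero 2 h), one_smul, smul_add] at h1
  conv_lhs => rw [h1]
  rw [planeNormal, inner_smul_right, smul_smul]
  congr 2 <;> field_simp

theorem eq_inner_smul_planeNormal (hreg : ∀ s, deriv c s ≠ 0) {s : ℝ} {v : Euc 2}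
    (h : inner ℝ v (deriv c s) = 0) : v = inner ℝ v (planeNormal c s) • planeNormal c s := by
  conv_lhs => rw [exists_eq_planeNormal_add hreg s v, h]
  simp

end Planar

/-! ### Consequences of non-overlap valid in every dimension -/

/-- Injectivity, pointwise and infinitesimal, of the normal tube of radius `b` about the closed
curve `c` along each unit normal field. -/
structure HasInjectiveTube {d : ℕ} (c : ℝ → Euc d) (L b : ℝ) : Prop where
  contDiff : ContDiff ℝ ∞ c
  regular : ∀ s, deriv c s ≠ 0
  periodic : Function.Periodic c L
  period_pos : 0 < L
  radius_pos : 0 < b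
  eq_of_eq : ∀ N, IsPeriodicNormalField c L N → ∀ s₁ s₂ t₁ t₂, t₁ ∈ Ioo 0 b → t₂ ∈ Ioo 0 b →
    c s₁ + t₁ • N s₁ = c s₂ + t₂ • N s₂ → ∃ n : ℤ, s₂ = s₁ + n * L
  eq_zero_of_eq_zero : ∀ N, IsPeriodicNormalField c L N → ∀ s, ∀ t ∈ Ioo 0 b, ∀ p q : ℝ,
    p • (deriv c s + t • deriv N s) + q • N s = 0 → p = 0 ∧ q = 0

theorem AddCircle.exists_eq_add_int_mul {L s t : ℝ} (h : (s : AddCircle L) = t) :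
    ∃ n : ℤ, t = s + n * L := by
  obtain ⟨n, hn⟩ := AddSubgroup.mem_zmultiples_iff.1 (QuotientAddGroup.eq.1 h)
  exact ⟨n, by rw [zsmul_eq_mul] at hn; linarith⟩

theorem TubeDoesNotOverlap.hasInjectiveTube {d : ℕ} {L b : ℝ} {γ : AddCircle L → Euc d}
    (hγ : IsClosedSmoothCurve γ) (hb : 0 < b) (h : TubeDoesNotOverlap γ b) :
    HasInjectiveTube (fun s : ℝ => γ (s : AddCircle L)) L b := by
  have hlift : ∀ N, IsPeriodicNormalField (fun s : ℝ => γ (s : AddCircle L)) L N →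
      ∃ M : AddCircle L → Euc d, IsUnitNormalField γ M ∧ ∀ s : ℝ, M s = N s := by
    intro N hN
    have hM : ∀ s : ℝ, hN.periodic.lift (s : AddCircle L) = N s := hN.periodic.lift_coe
    refine ⟨hN.periodic.lift, ⟨?_, fun q => ?_, fun s => ?_⟩, hM⟩
    · simpa only [hM] using hN.contDiff
    · obtain ⟨s, rfl⟩ := QuotientAddGroup.mk_surjective q
      exact (congrArg norm (hM s)).trans (hN.norm_eq_one s)
    · rw [hM]
      exact hN.inner_eq_zero s
  refine ⟨hγ.contDiff, hγ.regular, fun s => by simp, hγ.length_pos, hb, ?_, ?_⟩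
  · intro N hN s₁ s₂ t₁ t₂ ht₁ ht₂ heq
    obtain ⟨M, hM, hMN⟩ := hlift N hN
    have := (h M hM).1.injective (a₁ := ((s₁ : AddCircle L), ⟨t₁, ht₁⟩))
      (a₂ := ((s₂ : AddCircle L), ⟨t₂, ht₂⟩)) (by simpa only [hMN] using heq)
    exact AddCircle.exists_eq_add_int_mul (congrArg Prod.fst this)
  · intro N hN s t ht p q heq
    obtain ⟨M, hM, hMN⟩ := hlift N hN
    have hinj := (h M hM).2 s t ht
    simp only [hMN] at hinj
    have h1 := HasFDerivAt.comp (g := fun s : ℝ => γ (s : AddCircle L)) (s, t)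
      (hasDerivAt_of_contDiff_infty hγ.contDiff s).hasFDerivAt (hasFDerivAt_fst (𝕜 := ℝ) (F := ℝ))
    have h2 := HasFDerivAt.comp (g := N) (s, t)
      (hasDerivAt_of_contDiff_infty hN.contDiff s).hasFDerivAt (hasFDerivAt_fst (𝕜 := ℝ) (F := ℝ))
    have h3 := h1.add ((hasFDerivAt_snd (𝕜 := ℝ) (p := (s, t))).smul h2)
    have h4 : fderiv ℝ (fun p : ℝ × ℝ => γ (p.1 : AddCircle L) + p.2 • N p.1) (s, t) = _ :=
      h3.fderiv
    have h5 : fderiv ℝ (fun p : ℝ × ℝ => γ (p.1 : AddCircle L) + p.2 • N p.1) (s, t) (p, q) =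
        0 := by
      rw [h4, ← heq]
      simp [smul_smul, mul_comm, add_assoc]
    have := hinj (h5.trans (map_zero _).symm)
    simpa using this

namespace HasInjectiveTube

variable {d : ℕ} {c : ℝ → Euc d} {L b : ℝ}

/-- If `N' = αN + βc'`, then `c' + τN'` equals `(1 + τβ)c'` modulo `N`, so the tube map degenerates
at `τ = -1/β`. Differentiating `⟪N, c'⟫ = 0` gives `β‖c'‖² = -⟪N, c''⟫`, hence failure of the
inequality at `t` means `1 + tβ ≤ 0` and puts that degenerate `τ` in `(0, t]`. -/
theorem no_focal_point (H : HasInjectiveTube c L b) {N : ℝ → Euc d}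
    (hN : IsPeriodicNormalField c L N) {s : ℝ}
    (hαβ : ∃ α β : ℝ, deriv N s = α • N s + β • deriv c s) {t : ℝ} (ht : 0 < t) (htb : t < b) :
    inner ℝ (t • N s) (deriv (deriv c) s) < ‖deriv c s‖ ^ 2 := by
  obtain ⟨α, β, hd⟩ := hαβ
  have hT : 0 < ‖deriv c s‖ := norm_pos_iff.2 (H.regular s)
  have h1 := (hasDerivAt_of_contDiff_infty hN.contDiff s).inner ℝ
    (hasDerivAt_of_contDiff_infty (contDiff_deriv_of_contDiff_infty H.contDiff) s)
  have h2 : HasDerivAt (fun s => inner ℝ (N s) (deriv c s)) 0 s := by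
    simp only [hN.inner_eq_zero]
    exact hasDerivAt_const s 0
  have h3 := h1.unique h2
  rw [hd, inner_add_left, inner_smul_left, inner_smul_left, hN.inner_eq_zero,
    real_inner_self_eq_norm_sq] at h3
  simp only [conj_trivial, mul_zero, zero_add] at h3
  rw [inner_smul_left, conj_trivial]
  by_contra! hcon
  have hβ : 1 + t * β ≤ 0 := by
    by_contra! h
    nlinarith [mul_pos h (pow_pos hT 2)]
  have hβ0 : β < 0 := by
    by_contra! h
    nlinarith
  have hτ : -β⁻¹ ∈ Ioo 0 b := by
    have hpos : 0 < -β⁻¹ := by rw [neg_pos]; exact inv_lt_zero.2 hβ0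
    refine ⟨hpos, lt_of_le_of_lt ?_ htb⟩
    have h5 := mul_nonneg_of_nonpos_of_nonpos hβ (inv_lt_zero.2 hβ0).le
    have h6 : (1 + t * β) * β⁻¹ = β⁻¹ + t := by
      rw [add_mul, one_mul, mul_assoc, mul_inv_cancel₀ hβ0.ne, mul_one]
    linarith
  have h4 := (H.eq_zero_of_eq_zero N hN s _ hτ 1 (β⁻¹ * α) (by
    rw [hd]
    rw [show (1 : ℝ) • (deriv c s + -β⁻¹ • (α • N s + β • deriv c s)) + (β⁻¹ * α) • N s =
      (1 - β⁻¹ * β) • deriv c s by module, inv_mul_cancel₀ hβ0.ne, sub_self, zero_smul])).1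
  exact one_ne_zero h4

/-- Points near `c s₁ + y₁` have a foot near `s₁`. -/
theorem eventually_exists_foot (H : HasInjectiveTube c L b)
    (hJ : ∀ s y, inner ℝ y (deriv c s) = 0 → ‖y‖ < b →
      inner ℝ y (deriv (deriv c) s) < ‖deriv c s‖ ^ 2)
    {s₁ : ℝ} {y₁ : Euc d} (hy₁ : inner ℝ y₁ (deriv c s₁) = 0) (hy₁b : ‖y₁‖ < b)
    {P : ℝ × Euc d → Prop} (hP : ∀ᶠ p in 𝓝 (s₁, y₁), P p) :
    ∀ᶠ x in 𝓝 (c s₁ + y₁), ∃ s, inner ℝ (x - c s) (deriv c s) = 0 ∧ P (s, x - c s) := by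
  obtain ⟨σ, h1, h2, h3, -, -⟩ := exists_local_foot H.contDiff (x₀ := c s₁ + y₁) (s₀ := s₁)
    (by simpa using hy₁) (by
      have := hJ s₁ y₁ hy₁ hy₁b
      rw [footJacobian, add_sub_cancel_left]
      linarith)
  have hc := H.contDiff.continuous
  have hcont : ContinuousAt (fun x => (σ x, x - c (σ x))) (c s₁ + y₁) :=
    h1.continuousAt.prodMk
      (continuousAt_id.sub (hc.continuousAt.comp (f := σ) h1.continuousAt))
  have hlim : Tendsto (fun x => (σ x, x - c (σ x))) (𝓝 (c s₁ + y₁)) (𝓝 (s₁, y₁)) := by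
    have := hcont.tendsto
    rwa [h2, add_sub_cancel_left] at this
  filter_upwards [h3, hlim.eventually hP] with x hx hPx
  exact ⟨σ x, hx, hPx⟩

/-- The curve does not meet its own punctured normal tube, provided that normal vectors related by
`R` satisfy the injectivity property. -/
theorem ne_add_normal (H : HasInjectiveTube c L b)
    (hJ : ∀ s y, inner ℝ y (deriv c s) = 0 → ‖y‖ < b →
      inner ℝ y (deriv (deriv c) s) < ‖deriv c s‖ ^ 2)
    {R : ℝ → Euc d → ℝ → Euc d → Prop}
    (hR : ∀ s₁ y₁ s₂ y₂, R s₁ y₁ s₂ y₂ → inner ℝ y₁ (deriv c s₁) = 0 →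
      inner ℝ y₂ (deriv c s₂) = 0 → 0 < ‖y₁‖ → ‖y₁‖ < b → 0 < ‖y₂‖ → ‖y₂‖ < b →
      c s₁ + y₁ = c s₂ + y₂ → ∃ n : ℤ, s₂ = s₁ + n * L)
    {s₁ s₂ : ℝ} {y₁ n₂ : Euc d} (hy₁ : inner ℝ y₁ (deriv c s₁) = 0)
    (hy₁0 : 0 < ‖y₁‖) (hy₁b : ‖y₁‖ < b) (hn₂ : inner ℝ n₂ (deriv c s₂) = 0) (hn₂1 : ‖n₂‖ = 1)
    (hRn : ∀ᶠ p : ℝ × Euc d in 𝓝 (s₁, y₁), inner ℝ p.2 (deriv c p.1) = 0 → ∀ h : ℝ, 0 < h →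
      R p.1 p.2 s₂ (h • n₂)) :
    c s₁ + y₁ ≠ c s₂ := by
  -- Displace the common point by a small `h • n₂`. The displaced point still has a foot near `s₁`
  -- with normal vector near `y₁`, so the injectivity encoded by `R` identifies that foot with `s₂`
  -- modulo `L`. The normal vector would then have the small length `h`, although it is close to
  -- `y₁`.
  intro heq
  have hnear : ∀ᶠ p : ℝ × Euc d in 𝓝 (s₁, y₁), ‖y₁‖ / 2 < ‖p.2‖ ∧ ‖p.2‖ < b := by
    have hcont : ContinuousAt (fun p : ℝ × Euc d => ‖p.2‖) (s₁, y₁) := by fun_prop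
    exact (hcont.eventually_const_lt (show ‖y₁‖ / 2 < ‖y₁‖ by linarith)).and
      (hcont.eventually_lt_const hy₁b)
  have hlim : Tendsto (fun h : ℝ => c s₂ + h • n₂) (𝓝[>] 0) (𝓝 (c s₁ + y₁)) := by
    rw [heq]
    have : Tendsto (fun h : ℝ => c s₂ + h • n₂) (𝓝 0) (𝓝 (c s₂ + (0 : ℝ) • n₂)) :=
      Continuous.tendsto (by fun_prop) 0
    rw [zero_smul, add_zero] at this
    exact this.mono_left nhdsWithin_le_nhds
  have hsmall : ∀ᶠ h : ℝ in 𝓝[>] 0, h ∈ Ioo 0 (min (‖y₁‖ / 2) b) :=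
    Ioo_mem_nhdsGT (lt_min (by positivity) H.radius_pos)
  obtain ⟨h, ⟨s, hs, ⟨hsn, hsR⟩⟩, hh⟩ := ((hlim.eventually
    (H.eventually_exists_foot hJ hy₁ hy₁b (hnear.and hRn))).and hsmall).exists
  have hh0 : 0 < h := hh.1
  have hhn : ‖h • n₂‖ = h := by rw [norm_smul, hn₂1, mul_one, Real.norm_of_nonneg hh0.le]
  obtain ⟨n, hn⟩ := hR s _ s₂ (h • n₂) (hsR hs h hh0) hs (by rw [inner_smul_left, hn₂, mul_zero])
    (by linarith [hsn.1]) hsn.2 (by rwa [hhn])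
    (by rw [hhn]; exact hh.2.trans_le (min_le_right _ _)) (add_sub_cancel _ _)
  have hcs : c s₂ = c s := by rw [hn]; exact H.periodic.int_mul n s
  have h1 := hsn.1
  simp only [hcs, add_sub_cancel_left, hhn] at h1
  linarith [hh.2.trans_le (min_le_left _ _)]

end HasInjectiveTube

/-! ### Dimension at least three -/

section HighDimension

theorem exists_unit_normal {d : ℕ} (hd : 2 ≤ d) (T : Euc d) :
    ∃ n : Euc d, ‖n‖ = 1 ∧ inner ℝ n T = 0 := by
  have hlt : Module.finrank ℝ (Submodule.span ℝ {T}) < Module.finrank ℝ (Euc d) := by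
    rw [finrank_euclideanSpace_fin]
    exact (finrank_span_le_card {T}).trans_lt (by simp; lia)
  have hne : (Submodule.span ℝ {T})ᗮ ≠ ⊥ := by
    intro h
    rw [Submodule.orthogonal_eq_bot_iff] at h
    rw [h, finrank_top] at hlt
    exact lt_irrefl _ hlt
  obtain ⟨v, hv, hv0⟩ := Submodule.exists_mem_ne_zero_of_ne_bot hne
  refine ⟨‖v‖⁻¹ • v, ?_, ?_⟩
  · rw [norm_smul, norm_inv, norm_norm, inv_mul_cancel₀ (norm_ne_zero_iff.2 hv0)]
  · rw [inner_smul_left, real_inner_comm, Submodule.mem_orthogonal_singleton_iff_inner_right.1 hv,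
      mul_zero]

namespace HasInjectiveTube

variable {d : ℕ} {c : ℝ → Euc d} {L b : ℝ}

theorem no_focal_point_of_three_le (H : HasInjectiveTube c L b) (hd : 3 ≤ d) (s : ℝ) (y : Euc d)
    (hy : inner ℝ y (deriv c s) = 0) (hyb : ‖y‖ < b) :
    inner ℝ y (deriv (deriv c) s) < ‖deriv c s‖ ^ 2 := by
  rcases eq_or_ne y 0 with rfl | hy0
  · rw [inner_zero_left]
    have := norm_pos_iff.2 (H.regular s)
    positivity
  have hyn := norm_pos_iff.2 hy0
  -- The second prescribed normal plays no role; its parameter only has to differ from `s` modulo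
  -- `L`.
  obtain ⟨n, hn, hn'⟩ := exists_unit_normal (by lia) (deriv c (s + L / 2))
  obtain ⟨N, hN, h1, -, h2⟩ := exists_normalField_through_two hd H.contDiff H.regular H.periodic
    H.period_pos (s₁ := s) (s₂ := s + L / 2) (n₁ := ‖y‖⁻¹ • y) (n₂ := n) (by
      rintro ⟨k, hk⟩
      have : (2 * k : ℝ) * L = 1 * L := by linarith
      have := mul_right_cancel₀ H.period_pos.ne' this
      norm_cast at this
      lia) (by rw [norm_smul, norm_inv, norm_norm, inv_mul_cancel₀ hyn.ne']) hn
    (by rw [inner_smul_left, hy, mul_zero]) hn'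
  have := H.no_focal_point hN h2 hyn hyb
  rwa [h1, smul_smul, mul_inv_cancel₀ hyn.ne', one_smul] at this

theorem eq_of_add_normal_eq_of_three_le (H : HasInjectiveTube c L b) (hd : 3 ≤ d)
    {s₁ s₂ : ℝ} {y₁ y₂ : Euc d}
    (h₁ : inner ℝ y₁ (deriv c s₁) = 0) (h₂ : inner ℝ y₂ (deriv c s₂) = 0)
    (h₁0 : 0 < ‖y₁‖) (h₁b : ‖y₁‖ < b) (h₂0 : 0 < ‖y₂‖) (h₂b : ‖y₂‖ < b)
    (heq : c s₁ + y₁ = c s₂ + y₂) : ∃ n : ℤ, s₂ = s₁ + n * L := by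
  by_contra hs
  obtain ⟨N, hN, hN1, hN2, -⟩ := exists_normalField_through_two hd H.contDiff H.regular H.periodic
    H.period_pos hs (n₁ := ‖y₁‖⁻¹ • y₁) (n₂ := ‖y₂‖⁻¹ • y₂)
    (by rw [norm_smul, norm_inv, norm_norm, inv_mul_cancel₀ h₁0.ne'])
    (by rw [norm_smul, norm_inv, norm_norm, inv_mul_cancel₀ h₂0.ne'])
    (by rw [inner_smul_left, h₁, mul_zero]) (by rw [inner_smul_left, h₂, mul_zero])
  refine hs (H.eq_of_eq N hN s₁ s₂ ‖y₁‖ ‖y₂‖ ⟨h₁0, h₁b⟩ ⟨h₂0, h₂b⟩ ?_)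
  rwa [hN1, hN2, smul_smul, smul_smul, mul_inv_cancel₀ h₁0.ne', mul_inv_cancel₀ h₂0.ne', one_smul,
    one_smul]

/-- Displace a double point normally to the strand at `q`. The new point has a foot near `p`, not
congruent to `q`. If it lies on the curve, this contradicts `ne_add_normal`; otherwise it has two
nonzero normal representations with incongruent feet. -/
theorem injective_of_three_le (H : HasInjectiveTube c L b) (hd : 3 ≤ d) {p q : ℝ}
    (hpq : c p = c q) : ∃ n : ℤ, q = p + n * L := by
  by_contra hne
  have hJ := H.no_focal_point_of_three_le hd
  have hb := H.radius_pos
  obtain ⟨n₂, hn₂, hn₂'⟩ := exists_unit_normal (by lia) (deriv c q)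
  have hnear : ∀ᶠ r : ℝ × Euc d in 𝓝 (p, 0), ‖r.2‖ < b ∧ sinSq L q r.1 ≠ 0 := by
    have h1 : ContinuousAt (fun r : ℝ × Euc d => ‖r.2‖) (p, 0) := by fun_prop
    have h2 : ContinuousAt (fun r : ℝ × Euc d => sinSq L q r.1) (p, 0) :=
      ((contDiff_sinSq q).continuous.comp continuous_fst).continuousAt
    refine (h1.eventually_lt_const (by simpa using hb)).and (h2.eventually_ne ?_)
    intro h
    rw [sinSq_comm, sinSq_eq_zero_iff H.period_pos] at h
    exact hne h
  have hlim : Tendsto (fun h : ℝ => c q + h • n₂) (𝓝[>] 0) (𝓝 (c p + 0)) := by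
    rw [hpq]
    have : Tendsto (fun h : ℝ => c q + h • n₂) (𝓝 0) (𝓝 (c q + (0 : ℝ) • n₂)) :=
      Continuous.tendsto (by fun_prop) 0
    rw [zero_smul] at this
    exact this.mono_left nhdsWithin_le_nhds
  obtain ⟨h, ⟨s, hs, hsb, hsq⟩, hh⟩ := ((hlim.eventually
    (H.eventually_exists_foot hJ (by simp) (by simpa using hb) hnear)).and
    (Ioo_mem_nhdsGT hb)).exists
  have hhn : ‖h • n₂‖ = h := by rw [norm_smul, hn₂, mul_one, Real.norm_of_nonneg hh.1.le]
  have hn₂h : inner ℝ (h • n₂) (deriv c q) = 0 := by rw [inner_smul_left, hn₂', mul_zero]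
  rcases eq_or_ne (c q + h • n₂ - c s) 0 with h0 | h0
  · obtain ⟨m, hm, hm'⟩ := exists_unit_normal (by lia) (deriv c s)
    refine H.ne_add_normal hJ (R := fun _ _ _ _ => True) (fun s₁ y₁ s₂ y₂ _ =>
      H.eq_of_add_normal_eq_of_three_le hd) hn₂h (by rw [hhn]; exact hh.1)
      (by rw [hhn]; exact hh.2) hm' hm (by simp) (sub_eq_zero.1 h0)
  · obtain ⟨n, hn⟩ := H.eq_of_add_normal_eq_of_three_le hd hn₂h hs (by rw [hhn]; exact hh.1)
      (by rw [hhn]; exact hh.2) (norm_pos_iff.2 h0) hsb (by abel)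
    exact hsq ((sinSq_eq_zero_iff H.period_pos).2 ⟨n, hn⟩)

theorem nearest_unique_of_three_le (H : HasInjectiveTube c L b) (hd : 3 ≤ d) (x : Euc d)
    (hx : infDist x (range c) < b) (s t : ℝ) (hs : dist x (c s) = infDist x (range c))
    (ht : dist x (c t) = infDist x (range c)) : ∃ n : ℤ, t = s + n * L := by
  have hs' := inner_sub_deriv_eq_zero_of_nearest H.contDiff hs
  have ht' := inner_sub_deriv_eq_zero_of_nearest H.contDiff ht
  rcases (infDist_nonneg (x := x) (s := range c)).eq_or_lt with h0 | h0
  · rw [← h0, dist_eq_zero] at hs ht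
    exact H.injective_of_three_le hd (hs.symm.trans ht)
  · rw [dist_eq_norm] at hs ht
    exact H.eq_of_add_normal_eq_of_three_le hd hs' ht' (by rwa [hs]) (by rwa [hs]) (by rwa [ht])
      (by rwa [ht]) (by abel)

end HasInjectiveTube

end HighDimension

/-! ### The plane: absence of double points -/

section Plane

theorem inner_rotatePlane_rotatePlane (u v : Euc 2) :
    inner ℝ (rotatePlane u) (rotatePlane v) = inner ℝ u v := by
  simp [rotatePlane_apply, PiLp.inner_apply, Fin.sum_univ_two, add_comm]

namespace HasInjectiveTube

variable {c : ℝ → Euc 2} {L b : ℝ}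

theorem planeNormal_field (H : HasInjectiveTube c L b) :
    IsPeriodicNormalField c L (planeNormal c) :=
  isPeriodicNormalField_planeNormal H.contDiff H.regular H.periodic

theorem norm_smul_planeNormal (H : HasInjectiveTube c L b) (τ s : ℝ) :
    ‖τ • planeNormal c s‖ = |τ| := by
  rw [norm_smul, H.planeNormal_field.norm_eq_one, mul_one, Real.norm_eq_abs]

theorem inner_smul_planeNormal_deriv (H : HasInjectiveTube c L b) (τ s : ℝ) :
    inner ℝ (τ • planeNormal c s) (deriv c s) = 0 := by
  rw [inner_smul_left, H.planeNormal_field.inner_eq_zero, mul_zero]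

theorem inner_smul_planeNormal_self (H : HasInjectiveTube c L b) (τ s : ℝ) :
    inner ℝ (τ • planeNormal c s) (planeNormal c s) = τ := by
  rw [inner_smul_left, real_inner_self_eq_norm_sq, H.planeNormal_field.norm_eq_one]
  simp

/-- In the plane the derivative of a normal field always lies in the span of the normal and the
tangent, so `no_focal_point` applies to both `±N`. -/
theorem no_focal_point_plane (H : HasInjectiveTube c L b) (s : ℝ) (y : Euc 2)
    (hy : inner ℝ y (deriv c s) = 0) (hyb : ‖y‖ < b) :
    inner ℝ y (deriv (deriv c) s) < ‖deriv c s‖ ^ 2 := by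
  have hN := H.planeNormal_field
  have hy' := eq_inner_smul_planeNormal H.regular hy
  set τ := inner ℝ y (planeNormal c s)
  rw [hy', H.norm_smul_planeNormal] at hyb
  have hT := norm_pos_iff.2 (H.regular s)
  rw [hy']
  rcases lt_trichotomy τ 0 with h | h | h
  · rw [abs_of_neg h] at hyb
    have := H.no_focal_point hN.neg (s := s) ⟨_, _, by
      have := exists_eq_planeNormal_add H.regular s (deriv (fun s => -planeNormal c s) s)
      rw [← neg_smul_neg] at this
      exact this⟩ (neg_pos.2 h) hyb
    rwa [neg_smul_neg] at this
  · rw [h, zero_smul, inner_zero_left]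
    positivity
  · rw [abs_of_pos h] at hyb
    exact H.no_focal_point hN ⟨_, _, exists_eq_planeNormal_add H.regular s _⟩ h hyb

theorem eq_of_same_side (H : HasInjectiveTube c L b) {s₁ s₂ τ₁ τ₂ : ℝ} (hτ : 0 < τ₁ * τ₂)
    (h₁ : |τ₁| < b) (h₂ : |τ₂| < b)
    (heq : c s₁ + τ₁ • planeNormal c s₁ = c s₂ + τ₂ • planeNormal c s₂) :
    ∃ n : ℤ, s₂ = s₁ + n * L := by
  have hN := H.planeNormal_field
  rcases pos_and_pos_or_neg_and_neg_of_mul_pos hτ with ⟨h3, h4⟩ | ⟨h3, h4⟩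
  · rw [abs_of_pos h3] at h₁
    rw [abs_of_pos h4] at h₂
    exact H.eq_of_eq _ hN s₁ s₂ τ₁ τ₂ ⟨h3, h₁⟩ ⟨h4, h₂⟩ heq
  · rw [abs_of_neg h3] at h₁
    rw [abs_of_neg h4] at h₂
    refine H.eq_of_eq _ hN.neg s₁ s₂ (-τ₁) (-τ₂) ⟨neg_pos.2 h3, h₁⟩ ⟨neg_pos.2 h4, h₂⟩ ?_
    rwa [neg_smul_neg, neg_smul_neg]

theorem ne_add_smul_planeNormal (H : HasInjectiveTube c L b) {s₁ s₂ τ : ℝ} (hτ : τ ≠ 0)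
    (hτb : |τ| < b) : c s₁ + τ • planeNormal c s₁ ≠ c s₂ := by
  have hN := H.planeNormal_field
  -- Injectivity is available only on one side at a time, so `R` says that both normal vectors lie
  -- on the same side, and the displacement is taken on the side of `τ`.
  refine H.ne_add_normal H.no_focal_point_plane (R := fun s₁ y₁ s₂ y₂ =>
    0 < inner ℝ y₁ (planeNormal c s₁) * inner ℝ y₂ (planeNormal c s₂)) ?_
    (n₂ := (τ / |τ|) • planeNormal c s₂) (H.inner_smul_planeNormal_deriv _ _)
    (by rw [H.norm_smul_planeNormal]; positivity) (by rwa [H.norm_smul_planeNormal])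
    (H.inner_smul_planeNormal_deriv _ _) ?_ ?_
  · intro s₁ y₁ s₂ y₂ hR h1 h2 _ h3 _ h4 heq
    rw [eq_inner_smul_planeNormal H.regular h1, H.norm_smul_planeNormal] at h3
    rw [eq_inner_smul_planeNormal H.regular h2, H.norm_smul_planeNormal] at h4
    rw [eq_inner_smul_planeNormal H.regular h1, eq_inner_smul_planeNormal H.regular h2] at heq
    exact H.eq_of_same_side hR h3 h4 heq
  · rw [H.norm_smul_planeNormal, abs_div, abs_abs, div_self (abs_ne_zero.2 hτ)]
  · have hcont : ContinuousAt (fun p : ℝ × Euc 2 => inner ℝ p.2 (planeNormal c p.1) * τ)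
        (s₁, τ • planeNormal c s₁) := by
      have := hN.contDiff.continuous
      fun_prop
    have hpos : 0 < inner ℝ (τ • planeNormal c s₁) (planeNormal c s₁) * τ := by
      rw [H.inner_smul_planeNormal_self]
      exact mul_self_pos.2 hτ
    filter_upwards [hcont.eventually_const_lt hpos] with p hp _ h hh
    rw [smul_smul, H.inner_smul_planeNormal_self,
      show ∀ x : ℝ, x * (h * (τ / |τ|)) = x * τ * (h / |τ|) from fun x => by ring]
    positivity

/-- A local foot map about a point of the curve. -/
theorem exists_local_foot_on_curve (H : HasInjectiveTube c L b) (p : ℝ) :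
    ∃ σ : Euc 2 → ℝ, ContDiffAt ℝ 1 σ (c p) ∧ σ (c p) = p ∧
      (∀ᶠ x in 𝓝 (c p), inner ℝ (x - c (σ x)) (deriv c (σ x)) = 0) ∧
      (∀ᶠ v : Euc 2 × ℝ in 𝓝 (c p, p), inner ℝ (v.1 - c v.2) (deriv c v.2) = 0 → σ v.1 = v.2) ∧
      ∀ v, fderiv ℝ σ (c p) v = inner ℝ (deriv c p) v / ‖deriv c p‖ ^ 2 := by
  have hD : footJacobian c (c p) p = ‖deriv c p‖ ^ 2 := by simp [footJacobian]
  have := exists_local_foot H.contDiff (x₀ := c p) (s₀ := p) (by simp) (by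
    rw [hD]
    exact pow_ne_zero 2 (norm_ne_zero_iff.2 (H.regular p)))
  rwa [hD] at this

/-- The signed distance along the ray vanishes at `h = 0` and has derivative `⟪w, N p⟫` there, since
the moving foot contributes only a tangential term. -/
theorem eventually_side_pos (H : HasInjectiveTube c L b) {p : ℝ} {σ : Euc 2 → ℝ}
    (hσ : ContDiffAt ℝ 1 σ (c p)) (hp : σ (c p) = p) {w : Euc 2}
    (hw : 0 < inner ℝ w (planeNormal c p)) :
    ∀ᶠ h : ℝ in 𝓝[>] 0, 0 < inner ℝ (c p + h • w - c (σ (c p + h • w)))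
      (planeNormal c (σ (c p + h • w))) := by
  have hN := H.planeNormal_field
  have hline : HasDerivAt (fun h : ℝ => c p + h • w) w 0 := by
    simpa using ((hasDerivAt_id (0 : ℝ)).smul_const w).const_add (c p)
  have hl0 : c p + (0 : ℝ) • w = c p := by simp
  have hσl : HasDerivAt (fun h : ℝ => σ (c p + h • w)) _ 0 :=
    HasFDerivAt.comp_hasDerivAt (f := fun h : ℝ => c p + h • w) 0
      (by rw [hl0]; exact (hσ.differentiableAt one_ne_zero).hasFDerivAt) hline
  have hc1 : HasDerivAt (fun h : ℝ => c (σ (c p + h • w))) _ 0 :=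
    HasDerivAt.scomp (h := fun h : ℝ => σ (c p + h • w)) 0
      (hasDerivAt_of_contDiff_infty H.contDiff _) hσl
  have hn1 : HasDerivAt (fun h : ℝ => planeNormal c (σ (c p + h • w))) _ 0 :=
    HasDerivAt.scomp (h := fun h : ℝ => σ (c p + h • w)) 0
      (hasDerivAt_of_contDiff_infty hN.contDiff _) hσl
  have hd := (hline.sub hc1).inner ℝ hn1
  have hd' := hd.deriv
  simp only [Pi.sub_apply, hl0, hp, sub_self, inner_zero_left, zero_add] at hd'
  rw [inner_sub_left, inner_smul_left, real_inner_comm (planeNormal c p) (deriv c p),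
    hN.inner_eq_zero, mul_zero, sub_zero] at hd'
  have hsign := eventually_nhdsWithin_sign_eq_of_deriv_pos (x₀ := (0 : ℝ)) (by rw [hd']; exact hw)
    (by simp [hp])
  filter_upwards [nhdsWithin_le_nhds hsign, self_mem_nhdsWithin] with h h1 h2
  rw [sub_zero, sign_pos (a := h) h2, sign_eq_one_iff] at h1
  exact h1

theorem ne_of_not_congr (H : HasInjectiveTube c L b) {p q : ℝ} (hpq : ¬∃ n : ℤ, q = p + n * L)
    {f g : Euc 2 → ℝ} {x₀ : Euc 2} (hf : ContinuousAt f x₀) (hg : ContinuousAt g x₀)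
    (hfp : f x₀ = p) (hgq : g x₀ = q) : ∀ᶠ x in 𝓝 x₀, ¬∃ n : ℤ, g x = f x + n * L := by
  have hcont : ContinuousAt (fun x => sinSq L (f x) (g x)) x₀ := by
    unfold sinSq
    exact ((Real.continuous_sin.continuousAt.comp
      ((continuousAt_const.mul (hg.sub hf)).div_const L))).pow 2
  have h0 : sinSq L (f x₀) (g x₀) ≠ 0 := by
    rw [hfp, hgq]
    exact fun h => hpq ((sinSq_eq_zero_iff H.period_pos).1 h)
  filter_upwards [hcont.eventually_ne h0] with x hx hcon
  exact hx ((sinSq_eq_zero_iff H.period_pos).2 hcon)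

/-- If the tangents did not point in opposite directions, the sum of the two normals would point to
the positive side of both strands. A small displacement along it would have two incongruent feet on
the same side, against injectivity. -/
theorem inner_deriv_neg_of_double_point (H : HasInjectiveTube c L b) {p q : ℝ} (hpq : c p = c q)
    (hne : ¬∃ n : ℤ, q = p + n * L) : inner ℝ (deriv c q) (deriv c p) < 0 := by
  have hN := H.planeNormal_field
  have hb := H.radius_pos
  have hTp := norm_pos_iff.2 (H.regular p)
  have hTq := norm_pos_iff.2 (H.regular q)
  have hin : inner ℝ (planeNormal c q) (planeNormal c p) =
      ‖deriv c q‖⁻¹ * (‖deriv c p‖⁻¹ * inner ℝ (deriv c q) (deriv c p)) := by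
    rw [planeNormal, planeNormal, inner_smul_left, inner_smul_right,
      inner_rotatePlane_rotatePlane, conj_trivial]
  by_contra! hcon
  have hnn : 0 ≤ inner ℝ (planeNormal c q) (planeNormal c p) := by
    rw [hin]
    positivity
  have hself : ∀ s, inner ℝ (planeNormal c s) (planeNormal c s) = (1 : ℝ) := fun s => by
    rw [real_inner_self_eq_norm_sq, hN.norm_eq_one, one_pow]
  set w := planeNormal c p + planeNormal c q with hw
  obtain ⟨σ, h1, h2, h3, -, -⟩ := H.exists_local_foot_on_curve p
  obtain ⟨ρ, k1, k2, k3, -, -⟩ := H.exists_local_foot_on_curve q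
  have hsp := H.eventually_side_pos h1 h2 (w := w) (by
    rw [hw, inner_add_left, hself]
    linarith)
  have hsq := H.eventually_side_pos k1 k2 (w := w) (by
    rw [hw, inner_add_left, hself, real_inner_comm]
    linarith)
  rw [← hpq] at k1 k2 k3 hsq
  have hlim : Tendsto (fun h : ℝ => c p + h • w) (𝓝[>] 0) (𝓝 (c p)) := by
    have : Tendsto (fun h : ℝ => c p + h • w) (𝓝 0) (𝓝 (c p + (0 : ℝ) • w)) :=
      Continuous.tendsto (by fun_prop) 0
    rw [zero_smul, add_zero] at this
    exact this.mono_left nhdsWithin_le_nhds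
  have hcl : ∀ {f : Euc 2 → ℝ} {s : ℝ}, ContinuousAt f (c p) → f (c p) = s → c s = c p →
      ∀ᶠ x in 𝓝 (c p), ‖x - c (f x)‖ < b := by
    intro f s hf hfs hcs
    have hc := H.contDiff.continuous
    have : ContinuousAt (fun x => ‖x - c (f x)‖) (c p) :=
      (continuousAt_id.sub (hc.continuousAt.comp (f := f) hf)).norm
    refine this.eventually_lt_const ?_
    beta_reduce
    rw [hfs, hcs, sub_self, norm_zero]
    exact hb
  obtain ⟨h, ⟨⟨⟨⟨⟨e1, e2⟩, e3⟩, e4⟩, e5⟩, e6⟩, e7⟩ := ((((((hlim.eventually h3).and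
    (hlim.eventually k3)).and hsp).and hsq).and
    (hlim.eventually (hcl h1.continuousAt h2 rfl))).and
    (hlim.eventually (hcl k1.continuousAt k2 hpq.symm))).and
    (hlim.eventually (H.ne_of_not_congr hne h1.continuousAt k1.continuousAt h2 k2)) |>.exists
  rw [eq_inner_smul_planeNormal H.regular e1, H.norm_smul_planeNormal] at e5
  rw [eq_inner_smul_planeNormal H.regular e2, H.norm_smul_planeNormal] at e6
  refine e7 (H.eq_of_same_side (mul_pos e3 e4) e5 e6 ?_)
  rw [← eq_inner_smul_planeNormal H.regular e1, ← eq_inner_smul_planeNormal H.regular e2,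
    add_sub_cancel, add_sub_cancel]

/-- Near a double point, the other strand is traversed in the opposite direction. -/
theorem exists_closer_double_point (H : HasInjectiveTube c L b) {p q : ℝ} (hpq : c p = c q)
    (hne : ¬∃ n : ℤ, q = p + n * L) {ε : ℝ} (hε : 0 < ε) :
    ∃ p' q', c p' = c q' ∧ p < p' ∧ q' < q ∧ p' < p + ε ∧ q - ε < q' := by
  have hb := H.radius_pos
  have hneg := H.inner_deriv_neg_of_double_point hpq hne
  have hTq := norm_pos_iff.2 (H.regular q)
  obtain ⟨ρ, k1, k2, k3, -, k5⟩ := H.exists_local_foot_on_curve q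
  have hc := H.contDiff.continuous
  -- The derivative is negative, so the foot near `q` moves backwards as `s` moves forwards from
  -- `p`.
  have hg : HasDerivAt (fun s => ρ (c s))
      (inner ℝ (deriv c q) (deriv c p) / ‖deriv c q‖ ^ 2) p := by
    rw [← k5]
    exact HasFDerivAt.comp_hasDerivAt p
      (by rw [hpq]; exact (k1.differentiableAt one_ne_zero).hasFDerivAt)
      (hasDerivAt_of_contDiff_infty H.contDiff p)
  have hρp : ρ (c p) = q := by rw [hpq, k2]
  have hsign := eventually_nhdsWithin_sign_eq_of_deriv_pos (f := fun s => q - ρ (c s)) (x₀ := p)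
    (by
      rw [(hg.const_sub q).deriv]
      exact neg_pos.2 (div_neg_of_neg_of_pos hneg (by positivity)))
    (by simp [hρp])
  have hlim : Tendsto c (𝓝 p) (𝓝 (c q)) := hpq ▸ hc.continuousAt
  have hsmall : ∀ᶠ x in 𝓝 (c q), ‖x - c (ρ x)‖ < b := by
    have : ContinuousAt (fun x => ‖x - c (ρ x)‖) (c q) :=
      (continuousAt_id.sub (hc.continuousAt.comp (f := ρ) k1.continuousAt)).norm
    refine this.eventually_lt_const ?_
    beta_reduce
    rw [k2, sub_self, norm_zero]
    exact hb
  have hnear : ∀ᶠ s in 𝓝 p, q - ε < ρ (c s) :=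
    hg.continuousAt.eventually_const_lt (by beta_reduce; rw [hρp]; linarith)
  obtain ⟨s, ⟨⟨⟨⟨h1, h2⟩, h3⟩, h4⟩, h5⟩⟩ := (((((hsign.filter_mono nhdsWithin_le_nhds).and
    ((hlim.eventually k3).filter_mono nhdsWithin_le_nhds)).and
    ((hlim.eventually hsmall).filter_mono nhdsWithin_le_nhds)).and
    (hnear.filter_mono nhdsWithin_le_nhds)).and
    (Ioo_mem_nhdsGT (show p < p + ε by linarith))).exists
  rw [sign_pos (sub_pos.2 h5.1), sign_eq_one_iff] at h1
  refine ⟨s, ρ (c s), ?_, h5.1, by linarith, h5.2, h4⟩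
  have e := eq_inner_smul_planeNormal H.regular h2
  -- The curve does not meet its punctured normal tube, so the offset of `c s` from the strand at
  -- `q` is zero: the two strands coincide near the double point.
  rcases eq_or_ne (inner ℝ (c s - c (ρ (c s))) (planeNormal c (ρ (c s)))) 0 with h0 | h0
  · rw [h0, zero_smul] at e
    exact sub_eq_zero.1 e
  · rw [e, H.norm_smul_planeNormal] at h3
    refine absurd ?_ (H.ne_add_smul_planeNormal (s₁ := ρ (c s)) (s₂ := s) h0 h3)
    rw [← e, add_sub_cancel]

/-- Local uniqueness of the foot makes `c` locally injective. A Lebesgue number of the resulting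
cover of one period makes this uniform. -/
theorem exists_pos_forall_ne (H : HasInjectiveTube c L b) :
    ∃ δ, 0 < δ ∧ ∀ p m, 0 < m → m < δ → c p ≠ c (p + m) := by
  have hloc : ∀ p, ∃ U : Set ℝ, IsOpen U ∧ p ∈ U ∧ InjOn c U := by
    intro p
    obtain ⟨σ, -, -, -, h4, -⟩ := H.exists_local_foot_on_curve p
    rw [nhds_prod_eq, eventually_prod_iff] at h4
    obtain ⟨P, hP, Q, hQ, hPQ⟩ := h4
    obtain ⟨U, hU, hUo, hpU⟩ := _root_.eventually_nhds_iff.1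
      ((H.contDiff.continuous.continuousAt.eventually hP).and hQ)
    refine ⟨U, hUo, hpU, fun s hs t ht hst => ?_⟩
    have e1 : σ (c s) = s := hPQ (hU s hs).1 (hU s hs).2 (by simp)
    have e2 : σ (c s) = t := hPQ (hU s hs).1 (hU t ht).2 (by simp [hst])
    exact e1.symm.trans e2
  choose U hUo hpU hUi using hloc
  obtain ⟨δ, hδ, hball⟩ := lebesgue_number_lemma_of_metric (isCompact_Icc (a := (0 : ℝ)) (b := L))
    hUo fun p _ => mem_iUnion.2 ⟨p, hpU p⟩
  refine ⟨δ, hδ, fun p m hm hmδ heq => ?_⟩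
  obtain ⟨n, hn, -⟩ := existsUnique_add_zsmul_mem_Ico H.period_pos p 0
  simp only [zsmul_eq_mul, zero_add] at hn
  obtain ⟨i, hi⟩ := hball (p + n * L) ⟨hn.1, hn.2.le⟩
  have h1 : p + n * L ∈ ball (p + n * L) δ := mem_ball_self hδ
  have h2 : p + m + n * L ∈ ball (p + n * L) δ := by
    rw [mem_ball, Real.dist_eq, show p + m + n * L - (p + n * L) = m by ring, abs_of_pos hm]
    exact hmδ
  have := hUi i (hi h1) (hi h2) (by
    rw [H.periodic.int_mul n p, H.periodic.int_mul n (p + m), heq])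
  linarith

/-- Among all double points one has the least parameter gap, by compactness and because gaps are
bounded away from `0` and `L`. Moving both parameters towards each other by
`exists_closer_double_point` yields a smaller gap. -/
theorem injective_plane (H : HasInjectiveTube c L b) {p q : ℝ} (hpq : c p = c q) :
    ∃ n : ℤ, q = p + n * L := by
  by_contra hne
  have hL := H.period_pos
  have hc := H.contDiff.continuous
  obtain ⟨δ, hδ, hinj⟩ := H.exists_pos_forall_ne
  have hrange : ∀ p m, 0 < m → m < L → c p = c (p + m) → m ∈ Icc δ (L - δ) := by
    intro p m hm hmL h
    refine ⟨?_, ?_⟩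
    · by_contra! hlt
      exact hinj p m hm hlt h
    · by_contra! hlt
      refine hinj (p + m) (L - m) (by linarith) (by linarith) ?_
      rw [← h, show p + m + (L - m) = p + L by ring, H.periodic p]
  set Z : Set (ℝ × ℝ) := (Icc 0 L ×ˢ Icc δ (L - δ)) ∩ {z | c z.1 = c (z.1 + z.2)} with hZ
  have hZc : IsCompact Z := (isCompact_Icc.prod isCompact_Icc).inter_right
    (isClosed_eq (by fun_prop) (by fun_prop))
  have hmem : ∀ p m, 0 < m → m < L → c p = c (p + m) → ∃ p', (p', m) ∈ Z := by
    intro p m hm hmL h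
    obtain ⟨n, hn, -⟩ := existsUnique_add_zsmul_mem_Ico hL p 0
    simp only [zsmul_eq_mul, zero_add] at hn
    refine ⟨p + n * L, ⟨⟨⟨hn.1, hn.2.le⟩, hrange p m hm hmL h⟩, ?_⟩⟩
    change c (p + n * L) = c (p + n * L + m)
    rw [show p + n * L + m = p + m + n * L by ring, H.periodic.int_mul n p,
      H.periodic.int_mul n (p + m), h]
  have hZne : Z.Nonempty := by
    obtain ⟨n, hn, -⟩ := existsUnique_add_zsmul_mem_Ico hL q p
    simp only [zsmul_eq_mul] at hn
    have hlt : p < q + n * L := by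
      refine lt_of_le_of_ne hn.1 fun h => hne ⟨-n, ?_⟩
      push_cast
      linarith
    obtain ⟨p', hp'⟩ := hmem p (q + n * L - p) (by linarith) (by linarith [hn.2]) (by
      rw [add_sub_cancel, H.periodic.int_mul n q, hpq])
    exact ⟨_, hp'⟩
  obtain ⟨⟨p₀, m₀⟩, ⟨⟨-, hm₀⟩, hpm⟩, hmin⟩ := hZc.exists_isMinOn hZne continuous_snd.continuousOn
  have hm₀0 : 0 < m₀ := hδ.trans_le hm₀.1
  have hm₀L : m₀ < L := by linarith [hm₀.2]
  obtain ⟨p', q', h1, h2, h3, h4, h5⟩ := H.exists_closer_double_point (p := p₀) (q := p₀ + m₀) hpm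
    (by
      rintro ⟨n, hn⟩
      have e1 : m₀ = n * L := by linarith
      have e2 : (0 : ℝ) < n := pos_of_mul_pos_left (e1 ▸ hm₀0) hL.le
      have e3 : (n : ℝ) * L < 1 * L := by linarith
      have e4 := lt_of_mul_lt_mul_right e3 hL.le
      norm_cast at e2 e4
      lia) (half_pos hm₀0)
  obtain ⟨p'', hp''⟩ := hmem p' (q' - p') (by linarith) (by linarith) (by
    rw [add_sub_cancel, h1])
  have : m₀ ≤ q' - p' := hmin hp''
  linarith

end HasInjectiveTube

end Plane

/-! ### The plane: opposite sides and uniqueness of nearest points -/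

section PlaneNearest

theorem eq_of_coe_addCircle_eq_zero {f : ℝ → ℝ} (hf : Continuous f) {S : Set ℝ}
    (hS : IsPreconnected S) (h : ∀ x ∈ S, (f x : AddCircle (1 : ℝ)) = 0) {x y : ℝ} (hx : x ∈ S)
    (hy : y ∈ S) : f x = f y :=
  (AddCircle.isCoveringMap_coe (1 : ℝ)).constOn_of_comp hS hf.continuousOn
    (fun u hu v hv => (h u hu).trans (h v hv).symm) hx hy

namespace HasInjectiveTube

variable {c : ℝ → Euc 2} {L b : ℝ}

/-- A coincidence of both sides at small distances puts `c s` near `c q`, so by injectivity `s` is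
congruent to some `u` near `q`. Then `u` and `q` are both feet of one point near `c q`, hence equal,
and one signed distance would be both positive and negative. -/
theorem exists_side_gap (H : HasInjectiveTube c L b) (q : ℝ) :
    ∃ ε : ℝ, 0 < ε ∧ ∀ s τ τ' : ℝ, 0 < τ → τ ≤ ε → 0 < τ' → τ' ≤ ε →
      c q - τ • planeNormal c q ≠ c s + τ' • planeNormal c s := by
  have hN := H.planeNormal_field
  obtain ⟨σ, -, -, -, h4, -⟩ := H.exists_local_foot_on_curve q
  rw [nhds_prod_eq, eventually_prod_iff] at h4
  obtain ⟨P, hP, Q, hQ, hPQ⟩ := h4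
  obtain ⟨δ, hδ, hQδ⟩ := eventually_nhds_iff_ball.1 hQ
  have hnear := eventually_exists_nearest_mem_Ioo H.contDiff.continuous H.periodic H.period_pos hδ
    (x₀ := c q) (s₀ := q) fun t ht => by
      rw [infDist_zero_of_mem (mem_range_self q), dist_eq_zero] at ht
      exact H.injective_plane ht
  obtain ⟨η, hη, hηP⟩ := eventually_nhds_iff_ball.1 (hP.and hnear)
  refine ⟨η / 3, by positivity, fun s τ τ' hτ hτη hτ' hτη' heq => ?_⟩
  have hd1 : dist (c q - τ • planeNormal c q) (c q) = τ := by
    rw [dist_eq_norm, sub_sub_cancel_left, norm_neg, H.norm_smul_planeNormal, abs_of_pos hτ]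
  have hd2 : dist (c q - τ • planeNormal c q) (c s) = τ' := by
    rw [heq, dist_eq_norm, add_sub_cancel_left, H.norm_smul_planeNormal, abs_of_pos hτ']
  have hd3 : dist (c s) (c q) < η := by
    have := dist_triangle_left (c s) (c q) (c q - τ • planeNormal c q)
    linarith
  obtain ⟨u, hu, hus⟩ := (hηP (c s) hd3).2 s (by
    rw [dist_self, infDist_zero_of_mem (mem_range_self s)])
  obtain ⟨n, rfl⟩ := H.injective_plane hus
  rw [hN.periodic.int_mul n u, H.periodic.int_mul n u] at heq
  have hx := (hηP (c q - τ • planeNormal c q) (by rw [mem_ball, hd1]; linarith)).1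
  have e1 := hPQ hx (hQδ q (mem_ball_self hδ)) (by
    dsimp only
    rw [sub_sub_cancel_left, inner_neg_left, H.inner_smul_planeNormal_deriv, neg_zero])
  have e2 := hPQ hx (hQδ u (by rwa [Real.ball_eq_Ioo])) (by
    dsimp only
    rw [heq, add_sub_cancel_left, H.inner_smul_planeNormal_deriv])
  dsimp only at e1 e2
  rw [← e2, e1, sub_eq_add_neg, ← neg_smul, add_right_inj] at heq
  have h5 := congrArg (fun v => inner ℝ v (planeNormal c q)) heq
  simp only [H.inner_smul_planeNormal_self] at h5
  linarith

/-- A function of the signed distance, constant modulo `ℤ` near both ends of the positive side of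
the tube, extends continuously to the plane as a map to the circle. -/
theorem exists_circle_valued (H : HasInjectiveTube c L b) {ψ : ℝ → ℝ} (hψ : Continuous ψ)
    {ε₁ ε₂ : ℝ} (hε₁ : 0 < ε₁) (hε₂ : ε₂ < b) (h0 : ∀ τ ≤ ε₁, ψ τ = 0)
    (h1 : ∀ τ, ε₂ ≤ τ → ψ τ = 1) :
    ∃ G : C(Euc 2, AddCircle (1 : ℝ)),
      (∀ s τ, τ ∈ Ioo 0 b → G (c s + τ • planeNormal c s) = (ψ τ : AddCircle (1 : ℝ))) ∧
      ∀ x, (∀ s τ, τ ∈ Ioo 0 b → x ≠ c s + τ • planeNormal c s) → G x = 0 := by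
  classical
  have hN := H.planeNormal_field
  have hc := H.contDiff.continuous
  have hNc := hN.contDiff.continuous
  let G : Euc 2 → AddCircle (1 : ℝ) := fun x =>
    if h : ∃ z : ℝ × ℝ, z.2 ∈ Ioo 0 b ∧ x = c z.1 + z.2 • planeNormal c z.1 then
      (ψ h.choose.2 : AddCircle (1 : ℝ)) else 0
  have hG1 : ∀ s τ, τ ∈ Ioo 0 b →
      G (c s + τ • planeNormal c s) = (ψ τ : AddCircle (1 : ℝ)) := by
    intro s τ hτ
    have h : ∃ z : ℝ × ℝ, z.2 ∈ Ioo 0 b ∧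
        c s + τ • planeNormal c s = c z.1 + z.2 • planeNormal c z.1 := ⟨(s, τ), hτ, rfl⟩
    have hspec := h.choose_spec
    simp only [G]
    rw [dif_pos h]
    set z := h.choose
    obtain ⟨n, hn⟩ := H.eq_of_eq _ hN s z.1 τ z.2 hτ hspec.1 hspec.2
    have heq := hspec.2
    rw [hn, H.periodic.int_mul n s, hN.periodic.int_mul n s, add_right_inj] at heq
    have h5 := congrArg (fun v => inner ℝ v (planeNormal c s)) heq
    simp only [H.inner_smul_planeNormal_self] at h5
    rw [h5]
  have hG0 : ∀ x, (∀ s τ, τ ∈ Ioo 0 b → x ≠ c s + τ • planeNormal c s) → G x = 0 := by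
    intro x hx
    simp only [G]
    rw [dif_neg]
    rintro ⟨z, hz, he⟩
    exact hx z.1 z.2 hz he
  have hcoe : Continuous fun τ => (ψ τ : AddCircle (1 : ℝ)) :=
    (AddCircle.continuous_mk' 1).comp hψ
  have hcont : Continuous G := by
    rw [continuous_iff_continuousAt]
    intro x
    by_cases hx : ∃ z : ℝ × ℝ, z.2 ∈ Ioo 0 b ∧ x = c z.1 + z.2 • planeNormal c z.1
    · obtain ⟨⟨s, τ⟩, hτ, rfl⟩ := hx
      dsimp only at hτ ⊢
      intro U hU
      rw [hG1 s τ hτ] at hU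
      have hin : ContinuousAt (fun p : ℝ × Euc 2 => inner ℝ p.2 (planeNormal c p.1))
          (s, τ • planeNormal c s) := by fun_prop
      have hin' : Tendsto (fun p : ℝ × Euc 2 => inner ℝ p.2 (planeNormal c p.1))
          (𝓝 (s, τ • planeNormal c s)) (𝓝 τ) := by
        simpa only [H.inner_smul_planeNormal_self] using hin.tendsto
      have hIoo : ∀ᶠ τ' in 𝓝 τ, τ' ∈ Ioo 0 b := Ioo_mem_nhds hτ.1 hτ.2
      have hev := hin'.eventually (hIoo.and (hcoe.continuousAt.eventually hU))
      have := H.eventually_exists_foot H.no_focal_point_plane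
        (H.inner_smul_planeNormal_deriv τ s)
        (by rw [H.norm_smul_planeNormal, abs_of_pos hτ.1]; exact hτ.2) hev
      refine this.mono ?_
      rintro x ⟨s', hs', hI, hUx⟩
      have e := eq_inner_smul_planeNormal H.regular hs'
      change G x ∈ U
      rw [← add_sub_cancel (c s') x, e, hG1 _ _ hI]
      exact hUx
    -- Outside the compact set `K`, where `ψ` need not be an integer, `G` vanishes. This gives
    -- continuity off the positive side, including at its outer edge.
    · set K : Set (Euc 2) := (fun z : ℝ × ℝ => c z.1 + z.2 • planeNormal c z.1) ''
        (Icc 0 L ×ˢ Icc ε₁ ε₂) with hK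
      have hKc : IsClosed K :=
        ((isCompact_Icc.prod isCompact_Icc).image (by fun_prop)).isClosed
      have hzero : ∀ x ∉ K, G x = 0 := by
        intro x hxK
        by_cases hx : ∃ z : ℝ × ℝ, z.2 ∈ Ioo 0 b ∧ x = c z.1 + z.2 • planeNormal c z.1
        · obtain ⟨⟨s, τ⟩, hτ, rfl⟩ := hx
          dsimp only at hτ hxK ⊢
          rw [hG1 s τ hτ]
          by_cases h2 : τ ≤ ε₁
          · rw [h0 τ h2, AddCircle.coe_zero]
          by_cases h3 : ε₂ ≤ τ
          · rw [h1 τ h3, AddCircle.coe_period]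
          refine absurd ?_ hxK
          obtain ⟨n, hn, -⟩ := existsUnique_add_zsmul_mem_Ico H.period_pos s 0
          simp only [zsmul_eq_mul, zero_add] at hn
          refine ⟨(s + n * L, τ), ⟨⟨hn.1, hn.2.le⟩, ⟨(not_le.1 h2).le, (not_le.1 h3).le⟩⟩, ?_⟩
          dsimp only
          rw [H.periodic.int_mul n s, hN.periodic.int_mul n s]
        · exact hG0 x fun s τ hτ he => hx ⟨(s, τ), hτ, he⟩
      have hxK : x ∉ K := by
        rintro ⟨⟨s, τ⟩, ⟨-, hτ⟩, he⟩
        exact hx ⟨(s, τ), ⟨hε₁.trans_le hτ.1, hτ.2.trans_lt hε₂⟩, he.symm⟩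
      have : G =ᶠ[𝓝 x] fun _ => 0 := by
        filter_upwards [hKc.isOpen_compl.mem_nhds hxK] with y hy using hzero y hy
      exact continuousAt_const.congr this.symm
  exact ⟨⟨G, hcont⟩, hG1, hG0⟩

/-- A point on the positive side of the tube has no nearest point on the curve from which it lies
on the negative side. -/
theorem not_nearest_of_opposite_side (H : HasInjectiveTube c L b) {p q t r : ℝ} {x : Euc 2}
    (ht : t ∈ Ioo 0 b) (hr : 0 < r) (hxp : x = c p + t • planeNormal c p)
    (hxq : x = c q - r • planeNormal c q) : dist x (c q) ≠ infDist x (range c) := by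
  intro hnear
  have hN := H.planeNormal_field
  have hc := H.contDiff.continuous
  have hdq : ∀ τ, 0 ≤ τ → dist (c q - τ • planeNormal c q) (c q) = τ := fun τ hτ => by
    rw [dist_eq_norm, sub_sub_cancel_left, norm_neg, H.norm_smul_planeNormal, abs_of_nonneg hτ]
  have hinf : infDist x (range c) = r := by
    rw [← hnear, hxq, hdq r hr.le]
  obtain ⟨ε₀, hε₀, hgap⟩ := H.exists_side_gap q
  set ε := min ε₀ t with hε
  have hε0 : 0 < ε := lt_min hε₀ ht.1
  set ψ : ℝ → ℝ := fun τ => max 0 (min 1 (2 * τ / ε - 1)) with hψ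
  have hψc : Continuous ψ := by fun_prop
  have hψ0 : ∀ τ ≤ ε / 2, ψ τ = 0 := by
    intro τ hτ
    refine max_eq_left ((min_le_right _ _).trans ?_)
    rw [sub_nonpos, div_le_one hε0]
    linarith
  have hψ1 : ∀ τ, ε ≤ τ → ψ τ = 1 := by
    intro τ hτ
    have : 1 ≤ 2 * τ / ε - 1 := by
      rw [le_sub_iff_add_le, le_div_iff₀ hε0]
      linarith
    simp [hψ, min_eq_left this]
  -- Lift `G` to a real function `g` on the simply connected plane. It is constant on the curve and
  -- increases by `1` along the normal segment from `c p` to `x`. It is also constant along the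
  -- segment from `c q` to `x`, which is contradictory.
  obtain ⟨G, hG1, hG0⟩ := H.exists_circle_valued hψc (half_pos hε0)
    ((min_le_right _ _).trans_lt ht.2 : ε < b) hψ0 hψ1
  obtain ⟨e₀, he₀⟩ := QuotientAddGroup.mk_surjective (G x)
  obtain ⟨g, ⟨-, hg⟩, -⟩ := (AddCircle.isCoveringMap_coe (1 : ℝ)).existsUnique_continuousMap_lifts
    G x e₀ he₀
  have hgG : ∀ z, (g z : AddCircle (1 : ℝ)) = G z := fun z => congrFun hg z
  have hcurve : ∀ s, G (c s) = 0 := fun s => hG0 _ fun s' τ hτ =>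
    (H.ne_add_smul_planeNormal hτ.1.ne' (by rw [abs_of_pos hτ.1]; exact hτ.2)).symm
  have h1 : g (c p) = g (c q) :=
    eq_of_coe_addCircle_eq_zero (f := fun s => g (c s)) (g.continuous.comp hc) isPreconnected_univ
      (fun s _ => (hgG _).trans (hcurve s)) (mem_univ p) (mem_univ q)
  have h2 := eq_of_coe_addCircle_eq_zero
    (f := fun τ => g (c p + τ • planeNormal c p) - ψ τ) (S := Icc 0 t)
    ((g.continuous.comp (by fun_prop)).sub hψc) isPreconnected_Icc (by
      intro τ hτ
      rw [AddCircle.coe_sub, hgG]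
      rcases hτ.1.eq_or_lt with rfl | hτ0
      · rw [zero_smul, add_zero, hcurve, hψ0 0 (half_pos hε0).le, AddCircle.coe_zero, sub_zero]
      · rw [hG1 p τ ⟨hτ0, hτ.2.trans_lt ht.2⟩, sub_self])
    (left_mem_Icc.2 ht.1.le) (right_mem_Icc.2 ht.1.le)
  have h3 := eq_of_coe_addCircle_eq_zero
    (f := fun τ => g (c q - τ • planeNormal c q)) (S := Icc 0 r)
    (g.continuous.comp (by fun_prop)) isPreconnected_Icc (by
      intro τ hτ
      rw [hgG]
      rcases hτ.1.eq_or_lt with rfl | hτ0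
      · rw [zero_smul, sub_zero, hcurve]
      by_cases hex : ∃ z : ℝ × ℝ, z.2 ∈ Ioo 0 b ∧
          c q - τ • planeNormal c q = c z.1 + z.2 • planeNormal c z.1
      · obtain ⟨⟨s, τ'⟩, hτ', he⟩ := hex
        dsimp only at hτ' he
        rw [he, hG1 s τ' hτ', hψ1 τ', AddCircle.coe_period]
        -- Here `x` has distance `r` from the curve and distance `r - τ` from the current point, so
        -- `τ ≤ τ' < ε`. The current point would then lie on both sides at distances excluded by
        -- `exists_side_gap`.
        by_contra! hlt
        have hd1 := infDist_le_infDist_add_dist (s := range c) (x := x)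
          (y := c q - τ • planeNormal c q)
        have hd2 : dist x (c q - τ • planeNormal c q) = r - τ := by
          rw [hxq, dist_eq_norm, sub_sub_sub_cancel_left, ← sub_smul,
            H.norm_smul_planeNormal, abs_sub_comm, abs_of_nonneg (by linarith [hτ.2])]
        have hd3 : infDist (c q - τ • planeNormal c q) (range c) ≤ τ' := by
          refine (infDist_le_dist_of_mem (mem_range_self s)).trans ?_
          rw [he, dist_eq_norm, add_sub_cancel_left, H.norm_smul_planeNormal, abs_of_pos hτ'.1]
        have hle : ε ≤ ε₀ := min_le_left _ _
        exact hgap s τ τ' hτ0 (by linarith) hτ'.1 (by linarith) he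
      · exact hG0 _ fun s τ' hτ' he => hex ⟨(s, τ'), hτ', he⟩)
    (left_mem_Icc.2 hr.le) (right_mem_Icc.2 hr.le)
  rw [zero_smul, add_zero, ← hxp, hψ0 0 (half_pos hε0).le, hψ1 t (min_le_right _ _)] at h2
  rw [zero_smul, sub_zero, ← hxq] at h3
  linarith

theorem nearest_unique_plane (H : HasInjectiveTube c L b) (x : Euc 2)
    (hx : infDist x (range c) < b) (s t : ℝ) (hs : dist x (c s) = infDist x (range c))
    (ht : dist x (c t) = infDist x (range c)) : ∃ n : ℤ, t = s + n * L := by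
  have hN := H.planeNormal_field
  have es := eq_inner_smul_planeNormal H.regular
    (inner_sub_deriv_eq_zero_of_nearest H.contDiff hs)
  have et := eq_inner_smul_planeNormal H.regular
    (inner_sub_deriv_eq_zero_of_nearest H.contDiff ht)
  set τ₁ := inner ℝ (x - c s) (planeNormal c s)
  set τ₂ := inner ℝ (x - c t) (planeNormal c t)
  have hs' : |τ₁| = infDist x (range c) := by
    rw [← hs, dist_eq_norm, es, H.norm_smul_planeNormal]
  have ht' : |τ₂| = infDist x (range c) := by
    rw [← ht, dist_eq_norm, et, H.norm_smul_planeNormal]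
  rw [sub_eq_iff_eq_add'] at es et
  rcases (infDist_nonneg (x := x) (s := range c)).eq_or_lt with h0 | h0
  · rw [← h0, dist_eq_zero] at hs ht
    exact H.injective_plane (hs.symm.trans ht)
  rcases lt_trichotomy (τ₁ * τ₂) 0 with h | h | h
  · rcases mul_neg_iff.1 h with ⟨h1, h2⟩ | ⟨h1, h2⟩
    · rw [abs_of_pos h1] at hs'
      exact absurd ht (H.not_nearest_of_opposite_side ⟨h1, hs' ▸ hx⟩ (neg_pos.2 h2) es
        (by rwa [neg_smul, sub_neg_eq_add]))
    · rw [abs_of_pos h2] at ht'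
      exact absurd hs (H.not_nearest_of_opposite_side ⟨h2, ht' ▸ hx⟩ (neg_pos.2 h1) et
        (by rwa [neg_smul, sub_neg_eq_add]))
  · rcases mul_eq_zero.1 h with h1 | h1
    · rw [h1, abs_zero] at hs'
      exact absurd hs' h0.ne
    · rw [h1, abs_zero] at ht'
      exact absurd ht' h0.ne
  · exact H.eq_of_same_side h (hs'.trans_lt hx) (ht'.trans_lt hx) (es.symm.trans et)

end HasInjectiveTube

end PlaneNearest

theorem HasInjectiveTube.exists_isTubeCalibration {d : ℕ} {c : ℝ → Euc d} {L b : ℝ}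
    (H : HasInjectiveTube c L b) (hd : 2 ≤ d) : ∃ y f, IsTubeCalibration (range c) b y f := by
  rcases hd.eq_or_lt with rfl | hd'
  · exact _root_.exists_isTubeCalibration H.contDiff H.regular H.periodic H.period_pos
      H.no_focal_point_plane H.nearest_unique_plane
  · exact _root_.exists_isTubeCalibration H.contDiff H.regular H.periodic H.period_pos
      (H.no_focal_point_of_three_le hd') (H.nearest_unique_of_three_le hd')

theorem theorem1 {d : ℕ} (hd : 2 ≤ d) {L : ℝ}
    (γ : AddCircle L → EuclideanSpace ℝ (Fin d)) (hγ : IsClosedSmoothCurve γ)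
    (a : ℝ) (ha : 0 < a) (hno : ∃ b : ℝ, a < b ∧ TubeDoesNotOverlap γ b) :
    cheegerConstant (tube γ a) = ENNReal.ofReal (((d : ℝ) - 1) / a) ∧
      IsCheegerSet (tube γ a) (tube γ a) ∧
      ∀ C : Set (EuclideanSpace ℝ (Fin d)),
        IsCheegerSet (tube γ a) C → C =ᵐ[volume] tube γ a := by
  obtain ⟨b, hab, h⟩ := hno
  have H := h.hasInjectiveTube hγ (ha.trans hab)
  obtain ⟨y, f, hf⟩ := H.exists_isTubeCalibration hd
  have hrange : range (fun s : ℝ => γ (s : AddCircle L)) = range γ :=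
    QuotientAddGroup.mk_surjective.range_comp γ
  have := hf.isCheegerSet (isPreconnected_range H.contDiff.continuous) hd ha hab
  rwa [hrange] at this
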